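/- Let $H$ be a complex Hilbert space, $I\subseteq\mathbb R$ an interval, and let $S_I(H)$ be the set of bounded self-adjoint operators on $H$ with spectrum in $I$. Write $A\nabla_tB=(1-t)A+tB$, let $\le$ be the Loewner order, and let $f(A)$ be given by the continuous functional calculus. Let $f:I\to\mathbb R$ be of class $C^1(I)$ and operator convex, i.e. $f(A\nabla_tB)\le f(A)\nabla_t f(B)$ for all $A,B\in S_I(H)$ and $t\in[0,1]$. For $\lambda\in(0,1)$ let $\eta_\lambda$ be the probability measure on $[0,1]$ with $$d\eta_\lambda(t)=\frac{\lambda}{1-\lambda}\,t^{\frac{2\lambda-1}{1-\lambda}}\,dt,$$ and let $\eta_0=\delta_0$, $\eta_1=\delta_1$ (the weak limits). Let $$Df(A)(X)=\lim_{s\to0}\frac{f(A+sX)-f(A)}{s}$$ be the directional derivative (limit in operator norm, over real $s\ne0$ with $A+sX\in S_I(H)$). Then for all $A,B\in S_I(H)$ and $\lambda\in[0,1]$: the derivative $Df(A\nabla_tB)(B-A)$ exists for every $t\in[0,1]$, both integrands below are Bochner integrable with respect to $\eta_\lambda$, and $$0\le\int_0^1f(A\nabla_tB)\,d\eta_\lambda(t)-f(A\nabla_\lambda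 B)\le\int_0^1(t-\lambda)\,Df(A\nabla_tB)(B-A)\,d\eta_\lambda(t).$$ -/

import Mathlib

open MeasureTheory Filter Topology Set

noncomputable section

/-- The class `S_I(H)` of self-adjoint bounded operators on `H` with spectrum in `I`. -/
def selfAdjointWithSpectrumIn (H : Type*) [NormedAddCommGroup H] [InnerProductSpace ℂ H]
    [CompleteSpace H] (I : Set ℝ) : Set (H →L[ℂ] H) :=
  {A | IsSelfAdjoint A ∧ spectrum ℝ A ⊆ I}

/-- The weighted arithmetic mean `A ∇_t B = (1 - t) A + t B`. -/
def arithMean {H : Type*} [NormedAddCommGroup H] [InnerProductSpace ℂ H]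
    (A B : H →L[ℂ] H) (t : ℝ) : H →L[ℂ] H :=
  (1 - t) • A + t • B

/-- `f` is operator convex on `I` (for operators on `H`). Here `cfc f A` is the continuous
functional calculus `f(A)`, and `≤` is the Loewner order; continuity on `I` is what makes
`f(A)` meaningful for every `A ∈ S_I(H)`. -/
def OperatorConvexOn (H : Type*) [NormedAddCommGroup H] [InnerProductSpace ℂ H]
    [CompleteSpace H] (I : Set ℝ) (f : ℝ → ℝ) : Prop :=
  ContinuousOn f I ∧
    ∀ A ∈ selfAdjointWithSpectrumIn H I, ∀ B ∈ selfAdjointWithSpectrumIn H I,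
      ∀ t ∈ Icc (0 : ℝ) 1,
        cfc f (arithMean A B t) ≤ arithMean (cfc f A) (cfc f B) t

/-- `L` is the directional derivative of the operator function `f` at `A` in the direction `X`:
the norm limit of `(f(A + sX) - f(A)) / s` as `s → 0`, `s ≠ 0`, where `s` ranges over those reals
for which `f(A + sX)` is defined, that is, `A + sX ∈ S_I(H)`. This is the two-sided limit whenever
`A + sX ∈ S_I(H)` for all `s` near `0`, in particular when `I` is open. -/
def HasOperatorDirDeriv {H : Type*} [NormedAddCommGroup H] [InnerProductSpace ℂ H]
    [CompleteSpace H] (I : Set ℝ) (f : ℝ → ℝ) (A X L : H →L[ℂ] H) : Prop :=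
  Tendsto (fun s : ℝ => s⁻¹ • (cfc f (A + s • X) - cfc f A))
    (𝓝[{s : ℝ | s ≠ 0 ∧ A + s • X ∈ selfAdjointWithSpectrumIn H I}] 0) (𝓝 L)

open Classical in
/-- The directional derivative `Df(A)(X)` (set to `0` if the limit does not exist). -/
def operatorDirDeriv {H : Type*} [NormedAddCommGroup H] [InnerProductSpace ℂ H]
    [CompleteSpace H] (I : Set ℝ) (f : ℝ → ℝ) (A X : H →L[ℂ] H) : H →L[ℂ] H :=
  if h : ∃ L, HasOperatorDirDeriv I f A X L then h.choose else 0

/-- The probability measure `η_w` on `[0, 1]`. For `0 < w < 1` it has the density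
`w / (1 - w) * t ^ ((2 w - 1) / (1 - w))`; at the end points, where this density is not defined as
a probability density, `η_0 = δ_0` and `η_1 = δ_1`, the weak limits as `w → 0` and `w → 1`. -/
def weightMeasure (w : ℝ) : Measure ℝ :=
  if w = 0 then Measure.dirac 0
  else if w = 1 then Measure.dirac 1
  else (volume.restrict (Icc (0 : ℝ) 1)).withDensity
    (fun t => ENNReal.ofReal (w / (1 - w) * t ^ ((2 * w - 1) / (1 - w))))

end

/-! Write `φ t` for `f(A ∇_t B)` and `D t` for its directional derivative along `B - A`. Convexity
gives the gradient inequality `(u - t) • D t ≤ φ u - φ t` (`smul_dirDeriv_le`). The measure has mean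
`λ`, so integrating this at base point `λ` gives the lower bound, and taking base point `t` and
target `λ` gives the upper one (`jensen_of_subgradient`). The gradient inequality also makes `D`
monotone, hence bounded, and `D` is measurable because it is the derivative of `φ` inside `(0, 1)`.

The real difficulty is that `D` exists in norm: for a general `C¹` function in infinite dimension it
need not. Let `k` be the first divided difference of `f`. Apply convexity to a diagonal operator
with eigenvalues `c, x₁, …, xₙ`, averaged over two opposite small rotations. The second order term
in the angle shows that `(x - c)(y - c) f[x, c, y]` is a positive semidefinite kernel
(`sum_curvatureKernel_nonneg`). Up to a constant, `(M - m) k` is the difference of these kernels for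
`c = m` and `c = M`. Gram vectors and Dini's theorem then give `k(x, y) = ∑ g i x * h i y` with
uniformly small square tails (`exists_dividedDifference_factorization`).

It follows that `f(A) - f(B) = ∑ g i (A) (A - B) h i (B)`, where finite partial sums have error at
most `ε ‖A - B‖` (`norm_cfc_sub_cfc_sub_sum_le`). Difference quotients are therefore Cauchy. In
finite dimension an eigenbasis of `A` replaces the factorization. -/

/-! ### A trace identity in a real Hilbert space. -/

section RealHilbert

/-- Two square-summable families in a real Hilbert space whose rank-one forms
`ζ ↦ ∑ ⟪P i, ζ⟫ * ⟪ζ, Q i⟫` vanish have vanishing total inner product. -/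
theorem hasSum_inner_eq_zero_of_forall {E ι : Type*} [NormedAddCommGroup E]
    [InnerProductSpace ℝ E] [CompleteSpace E] {P Q : ι → E}
    (hP : Summable fun i => ‖P i‖ ^ 2) (hQ : Summable fun i => ‖Q i‖ ^ 2)
    (h : ∀ ζ : E, HasSum (fun i => inner ℝ (P i) ζ * inner ℝ ζ (Q i)) 0) :
    HasSum (fun i => inner ℝ (P i) (Q i)) 0 := by
  obtain ⟨w, b, -⟩ := exists_hilbertBasis ℝ E
  have sq : ∀ {R : ι → E}, (Summable fun i => ‖R i‖ ^ 2) →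
      Summable fun p : ι × w => inner ℝ (R p.1) (b p.2) ^ 2 := by
    intro R hR
    have key : ∀ i, HasSum (fun j => inner ℝ (R i) (b j) ^ 2) (‖R i‖ ^ 2) := by
      intro i
      have := b.hasSum_inner_mul_inner (R i) (R i)
      rw [real_inner_self_eq_norm_sq] at this
      refine this.congr_fun ?_ |> fun h => h
      intro j
      rw [real_inner_comm (R i) (b j), sq]
    rw [summable_prod_of_nonneg (fun p => sq_nonneg _)]
    refine ⟨fun i => (key i).summable, ?_⟩
    simpa only [(key _).tsum_eq] using hR
  -- The conclusion is the trace of the form, summed over `ζ = b j`. Absolute summability over `ι ×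
  -- w` permits exchanging the two sums.
  have hs : Summable fun p : ι × w => inner ℝ (P p.1) (b p.2) * inner ℝ (b p.2) (Q p.1) := by
    refine Summable.of_norm_bounded ((sq hP).add (sq hQ)) fun p => ?_
    rw [Real.norm_eq_abs, abs_le, real_inner_comm (Q p.1) (b p.2)]
    constructor <;> nlinarith [sq_nonneg (inner ℝ (P p.1) (b p.2) + inner ℝ (Q p.1) (b p.2)),
      sq_nonneg (inner ℝ (P p.1) (b p.2) - inner ℝ (Q p.1) (b p.2)),
      sq_nonneg (inner ℝ (P p.1) (b p.2)), sq_nonneg (inner ℝ (Q p.1) (b p.2))]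
  have hi : ∀ i, ∑' j, inner ℝ (P i) (b j) * inner ℝ (b j) (Q i) = inner ℝ (P i) (Q i) :=
    fun i => b.tsum_inner_mul_inner _ _
  have hsum : Summable fun i => inner ℝ (P i) (Q i) := by
    simpa only [hi] using hs.prod
  have h0 : ∑' i, inner ℝ (P i) (Q i) = 0 := by
    have hcomm := Summable.tsum_comm (f := fun i j => inner ℝ (P i) (b j) * inner ℝ (b j) (Q i)) hs
    simp only [hi, (h _).tsum_eq, tsum_zero] at hcomm
    exact hcomm.symm
  exact h0 ▸ hsum.hasSum

end RealHilbert

/-! ### Vanishing tensor series evaluated at two operators. -/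

section Families

variable {ι : Type*} {J : Set ℝ}

/-- Bounded square sums make a pointwise vanishing series with square-summable coefficients vanish
uniformly. -/
theorem tendstoUniformlyOn_sum_mul_zero {h : ι → ℝ → ℝ} {C : ℝ}
    (hC : ∀ F : Finset ι, ∀ x ∈ J, ∑ i ∈ F, h i x ^ 2 ≤ C) {s : ι → ℝ}
    (hs : Summable fun i => s i ^ 2) (h0 : ∀ y ∈ J, HasSum (fun i => s i * h i y) 0) :
    TendstoUniformlyOn (fun (F : Finset ι) y => ∑ i ∈ F, s i * h i y) (fun _ => 0) atTop J := by
  classical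
  rw [Metric.tendstoUniformlyOn_iff]
  intro ε hε
  have hC' : 0 < |C| + 1 := by positivity
  -- By Cauchy–Schwarz a tail squared is at most this tolerance times `|C| + 1`, that is `ε ^ 2 /
  -- 4`.
  obtain ⟨F₀, hF₀⟩ := summable_iff_vanishing_norm.1 hs (ε ^ 2 / (4 * (|C| + 1))) (by positivity)
  filter_upwards [eventually_ge_atTop F₀] with F hF y hy
  have hbd : ∀ F', F ≤ F' →
      (∑ i ∈ F', s i * h i y - ∑ i ∈ F, s i * h i y) ^ 2 ≤ ε ^ 2 / 4 := by
    intro F' hFF'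
    rw [← Finset.sum_sdiff (show F ⊆ F' from hFF'), add_sub_cancel_right]
    refine (Finset.sum_mul_sq_le_sq_mul_sq _ _ _).trans ?_
    have h1 := hF₀ (F' \ F) (Finset.disjoint_left.2 fun i hi hi' =>
      (Finset.mem_sdiff.1 hi).2 (hF hi'))
    rw [Real.norm_eq_abs] at h1
    have h2 := hC (F' \ F) y hy
    calc (∑ i ∈ F' \ F, s i ^ 2) * ∑ i ∈ F' \ F, h i y ^ 2
        ≤ (ε ^ 2 / (4 * (|C| + 1))) * (|C| + 1) := by
          refine mul_le_mul ((le_abs_self _).trans h1.le) ?_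
            (Finset.sum_nonneg fun _ _ => sq_nonneg _) (by positivity)
          linarith [le_abs_self C]
      _ = ε ^ 2 / 4 := by field_simp
  have hlim : Tendsto (fun F' : Finset ι =>
      (∑ i ∈ F', s i * h i y - ∑ i ∈ F, s i * h i y) ^ 2) atTop
      (𝓝 ((0 - ∑ i ∈ F, s i * h i y) ^ 2)) := ((h0 y hy).sub_const _).pow 2
  have := le_of_tendsto hlim ((eventually_ge_atTop F).mono hbd)
  rw [Real.dist_eq, abs_lt]
  constructor <;> nlinarith

variable {H : Type*} [NormedAddCommGroup H] [InnerProductSpace ℂ H] [CompleteSpace H]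

/-- The left side is `⟪η, (∑ g i ²)(A) η⟫`, so a scalar bound on the square sum passes to vectors.
-/
theorem sum_norm_sq_cfc_apply_le {A : H →L[ℂ] H} (hA : A ∈ selfAdjointWithSpectrumIn H J)
    {g : ι → ℝ → ℝ} (hg : ∀ i, ContinuousOn (g i) J) (F : Finset ι) {C : ℝ} (hC0 : 0 ≤ C)
    (hC : ∀ x ∈ J, ∑ i ∈ F, g i x ^ 2 ≤ C) (η : H) :
    ∑ i ∈ F, ‖cfc (g i) A η‖ ^ 2 ≤ C * ‖η‖ ^ 2 := by
  have hA1 : IsSelfAdjoint A := hA.1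
  have hc : ∀ i, ContinuousOn (g i) (spectrum ℝ A) := fun i => (hg i).mono hA.2
  have h1 : ∀ i, ‖cfc (g i) A η‖ ^ 2 = Complex.re (inner ℂ η (cfc (fun x => g i x ^ 2) A η)) := by
    intro i
    have hsa : IsSelfAdjoint (cfc (g i) A) := cfc_predicate _ _
    rw [cfc_pow (g i) 2 A (hc i), pow_two (cfc (g i) A), mul_apply_eq_comp]
    conv_rhs => rw [← hsa.adjoint_eq]
    rw [ContinuousLinearMap.adjoint_inner_right, hsa.adjoint_eq, inner_self_eq_norm_sq_to_K]
    norm_cast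
  have h2 : ∑ i ∈ F, ‖cfc (g i) A η‖ ^ 2
      = Complex.re (inner ℂ η (cfc (fun x => ∑ i ∈ F, g i x ^ 2) A η)) := by
    rw [show (fun x => ∑ i ∈ F, g i x ^ 2) = ∑ i ∈ F, fun x => g i x ^ 2 by ext; simp,
      cfc_sum (fun i x => g i x ^ 2) A F (fun i _ => (hc i).pow 2)]
    simp only [h1, _root_.sum_apply, inner_sum, Complex.re_sum]
  rw [h2]
  have hn : ‖cfc (fun x => ∑ i ∈ F, g i x ^ 2) A‖ ≤ C := by
    refine norm_cfc_le hC0 fun x hx => ?_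
    rw [Real.norm_eq_abs, abs_of_nonneg (Finset.sum_nonneg fun _ _ => sq_nonneg _)]
    exact hC x (hA.2 hx)
  calc Complex.re (inner ℂ η (cfc (fun x => ∑ i ∈ F, g i x ^ 2) A η))
      ≤ ‖inner ℂ η (cfc (fun x => ∑ i ∈ F, g i x ^ 2) A η)‖ := Complex.re_le_norm _
    _ ≤ ‖η‖ * ‖cfc (fun x => ∑ i ∈ F, g i x ^ 2) A η‖ := norm_inner_le_norm _ _
    _ ≤ ‖η‖ * (C * ‖η‖) := by
        gcongr
        exact ContinuousLinearMap.le_of_opNorm_le _ hn _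
    _ = C * ‖η‖ ^ 2 := by ring

theorem summable_norm_sq_cfc_apply {A : H →L[ℂ] H} (hA : A ∈ selfAdjointWithSpectrumIn H J)
    {g : ι → ℝ → ℝ} (hg : ∀ i, ContinuousOn (g i) J) {C : ℝ}
    (hC : ∀ F : Finset ι, ∀ x ∈ J, ∑ i ∈ F, g i x ^ 2 ≤ C) (η : H) :
    Summable fun i => ‖cfc (g i) A η‖ ^ 2 :=
  summable_of_sum_le (fun _ => sq_nonneg _) fun F =>
    sum_norm_sq_cfc_apply_le hA hg F (abs_nonneg C)
      (fun x hx => (hC F x hx).trans (le_abs_self C)) η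

/-- The scalar partial sums vanish uniformly in the limit, so those of the functional calculus
vanish in norm. -/
theorem hasSum_smul_cfc_apply_zero {B : H →L[ℂ] H} (hB : B ∈ selfAdjointWithSpectrumIn H J)
    {h : ι → ℝ → ℝ} (hh : ∀ i, ContinuousOn (h i) J) {C : ℝ}
    (hC : ∀ F : Finset ι, ∀ x ∈ J, ∑ i ∈ F, h i x ^ 2 ≤ C) {s : ι → ℝ}
    (hs : Summable fun i => s i ^ 2) (h0 : ∀ y ∈ J, HasSum (fun i => s i * h i y) 0) (ξ : H) :
    HasSum (fun i => s i • cfc (h i) B ξ) 0 := by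
  have hB1 : IsSelfAdjoint B := hB.1
  have hc : ∀ i, ContinuousOn (h i) (spectrum ℝ B) := fun i => (hh i).mono hB.2
  have hu := (tendstoUniformlyOn_sum_mul_zero hC hs h0).mono hB.2
  have ht := tendsto_cfc_fun (a := B) hu (Eventually.of_forall fun F => by fun_prop)
  rw [cfc_const_zero] at ht
  have ht2 := ((ContinuousLinearMap.apply ℂ H ξ).continuous.tendsto 0).comp ht
  simp only [map_zero] at ht2
  refine ht2.congr fun F => ?_
  have : (fun x => ∑ i ∈ F, s i * h i x) = ∑ i ∈ F, fun x => s i • h i x := by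
    ext; simp
  simp only [Function.comp, ContinuousLinearMap.apply_apply]
  rw [this, cfc_sum (fun i x => s i • h i x) B F (fun i _ => (hc i).const_smul (s i)), _root_.sum_apply]
  refine Finset.sum_congr rfl fun i _ => ?_
  rw [cfc_smul (s i) (h i) B (hc i), _root_.smul_apply]

/-- If `∑ g i x * h i y = 0` on `J × J` with bounded square sums, then `∑ g i (A) h i (B) = 0`
weakly. -/
theorem hasSum_re_inner_cfc_eq_zero {A B : H →L[ℂ] H} (hA : A ∈ selfAdjointWithSpectrumIn H J)
    (hB : B ∈ selfAdjointWithSpectrumIn H J) {g h : ι → ℝ → ℝ}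
    (hg : ∀ i, ContinuousOn (g i) J) (hh : ∀ i, ContinuousOn (h i) J) {C D : ℝ}
    (hC : ∀ F : Finset ι, ∀ x ∈ J, ∑ i ∈ F, g i x ^ 2 ≤ C)
    (hD : ∀ F : Finset ι, ∀ x ∈ J, ∑ i ∈ F, h i x ^ 2 ≤ D)
    (h0 : ∀ x ∈ J, ∀ y ∈ J, HasSum (fun i => g i x * h i y) 0) (η ξ : H) :
    HasSum (fun i => Complex.re (inner ℂ (cfc (g i) A η) (cfc (h i) B ξ))) 0 := by
  let _ : InnerProductSpace ℝ H := InnerProductSpace.rclikeToReal ℂ H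
  have hP := summable_norm_sq_cfc_apply hA hg hC η
  have hQ := summable_norm_sq_cfc_apply hB hh hD ξ
  refine hasSum_inner_eq_zero_of_forall hP hQ fun ζ => ?_
  have hs : Summable fun i => inner ℝ (cfc (g i) A η) ζ ^ 2 := by
    refine Summable.of_nonneg_of_le (fun _ => sq_nonneg _) (fun i => ?_) (hP.mul_right (‖ζ‖ ^ 2))
    rw [← mul_pow, ← sq_abs]
    gcongr
    exact abs_real_inner_le_norm _ _
  -- The variables are replaced one at a time: here `x` becomes `A` with `y` frozen, and afterwards
  -- `y` becomes `B`.
  have h1 : ∀ y ∈ J, HasSum (fun i => inner ℝ (cfc (g i) A η) ζ * h i y) 0 := by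
    intro y hy
    have hsy : Summable fun i => h i y ^ 2 :=
      summable_of_sum_le (fun _ => sq_nonneg _) fun F => hD F y hy
    have := hasSum_smul_cfc_apply_zero hA hg hC hsy
      (fun x hx => by simpa only [mul_comm] using h0 x hx y hy) η
    have := this.mapL (innerSL ℝ ζ)
    simp only [map_zero, map_smul, innerSL_apply_apply, smul_eq_mul] at this
    simpa only [mul_comm, real_inner_comm] using this
  have := (hasSum_smul_cfc_apply_zero hB hh hD hs h1 ξ).mapL (innerSL ℝ ζ)
  simpa only [map_zero, map_smul, innerSL_apply_apply, smul_eq_mul] using this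

end Families

/-! ### Gram vectors and uniformly convergent features of a continuous positive kernel. -/

section Kernels

/-- A positive semidefinite real kernel is a Gram kernel. -/
theorem exists_gram_of_posSemidef {K : ℝ → ℝ → ℝ} (hsymm : ∀ x y, K x y = K y x)
    (hpsd : ∀ (s : Finset ℝ) (c : ℝ → ℝ), 0 ≤ ∑ x ∈ s, ∑ y ∈ s, c x * c y * K x y) :
    ∃ (E : Type) (_ : NormedAddCommGroup E) (_ : InnerProductSpace ℝ E) (_ : CompleteSpace E)
      (u : ℝ → E), ∀ x y, inner ℝ (u x) (u y) = K x y := by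
  let N : Matrix ℝ ℝ (ℝ →L[ℝ] ℝ) := .of fun x y => K x y • (1 : ℝ →L[ℝ] ℝ)
  have hN : N.PosSemidef := by
    have hiff := (RKHS.posSemidef_tfae (K := N)).out 0 2
    refine hiff.2 ⟨?_, fun v => ?_⟩
    · ext x y
      simp [N, Matrix.conjTranspose_apply, hsymm x y]
    · refine (hpsd v.support v).trans_eq ?_
      simp only [Finsupp.sum, N, Matrix.of_apply]
      simp only [RCLike.re_to_real]
      refine Finset.sum_congr rfl fun x _ => Finset.sum_congr rfl fun y _ => ?_
      simp [hsymm x y]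
      ring
  have : Fact N.PosSemidef := ⟨hN⟩
  refine ⟨RKHS.OfKernel N, inferInstance, inferInstance, inferInstance,
    fun x => RKHS.kerFun (RKHS.OfKernel N) x 1, fun x y => ?_⟩
  rw [← RKHS.kernel_inner, RKHS.OfKernel.kernel_ofKernel]
  simp [N, hsymm x y]

/-- The features are the coordinates of the Gram vectors in a Hilbert basis. On the diagonal their
squares increase to the continuous function `K x x`, so Dini's theorem makes the tails uniform. -/
theorem exists_continuous_features {K : ℝ → ℝ → ℝ} (hK : Continuous (Function.uncurry K))
    (hsymm : ∀ x y, K x y = K y x)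
    (hpsd : ∀ (s : Finset ℝ) (c : ℝ → ℝ), 0 ≤ ∑ x ∈ s, ∑ y ∈ s, c x * c y * K x y)
    {J : Set ℝ} (hJ : IsCompact J) :
    ∃ (ι : Type) (e : ι → ℝ → ℝ), (∀ i, Continuous (e i)) ∧
      (∀ x y, HasSum (fun i => e i x * e i y) (K x y)) ∧
      ∀ ε > 0, ∃ F₀ : Finset ι, ∀ F : Finset ι, Disjoint F F₀ → ∀ x ∈ J,
        ∑ i ∈ F, e i x ^ 2 ≤ ε := by
  classical
  obtain ⟨E, _, _, _, u, hu⟩ := exists_gram_of_posSemidef hsymm hpsd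
  have hu_cont : Continuous u := by
    rw [continuous_iff_continuousAt]
    intro x₀
    rw [ContinuousAt, tendsto_iff_norm_sub_tendsto_zero]
    have hsq : ∀ x, ‖u x - u x₀‖ = √(K x x - 2 * K x x₀ + K x₀ x₀) := by
      intro x
      rw [← hu, ← hu, ← hu, real_inner_self_eq_norm_sq, real_inner_self_eq_norm_sq,
        ← norm_sub_sq_real, Real.sqrt_sq (norm_nonneg _)]
    simp only [hsq]
    have h1 : Continuous fun x => K x x := hK.comp (continuous_id.prodMk continuous_id)
    have h2 : Continuous fun x => K x x₀ := hK.comp (continuous_id.prodMk continuous_const)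
    have : Continuous fun x => √(K x x - 2 * K x x₀ + K x₀ x₀) := by fun_prop
    convert! this.tendsto x₀ using 2
    ring_nf
    simp
  obtain ⟨w, b, -⟩ := exists_hilbertBasis ℝ E
  have hsum : ∀ x y, HasSum (fun i => inner ℝ (b i) (u x) * inner ℝ (b i) (u y)) (K x y) := by
    intro x y
    have := b.hasSum_inner_mul_inner (u x) (u y)
    simpa only [hu, real_inner_comm] using this
  refine ⟨w, fun i x => inner ℝ (b i) (u x), fun i => by fun_prop, hsum, fun ε hε => ?_⟩
  have hdini : TendstoUniformlyOn (fun (F : Finset w) x => ∑ i ∈ F, inner ℝ (b i) (u x) ^ 2)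
      (fun x => K x x) atTop J := by
    refine Monotone.tendstoUniformlyOn_of_forall_tendsto hJ (fun F => by fun_prop)
      (fun x _ F F' hFF' => Finset.sum_le_sum_of_subset_of_nonneg hFF' fun _ _ _ => sq_nonneg _)
      (hK.comp (continuous_id.prodMk continuous_id)).continuousOn fun x _ => ?_
    simp only [sq]
    exact hsum x x
  rw [Metric.tendstoUniformlyOn_iff] at hdini
  obtain ⟨F₀, hF₀⟩ := (hdini ε hε).exists
  refine ⟨F₀, fun F hF x hx => ?_⟩
  have h1 := hF₀ x hx
  have h2 : ∑ i ∈ F ∪ F₀, inner ℝ (b i) (u x) ^ 2 ≤ K x x := by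
    have h3 : HasSum (fun i => inner ℝ (b i) (u x) ^ 2) (K x x) := by
      simpa only [sq] using hsum x x
    exact sum_le_hasSum _ (fun _ _ => sq_nonneg _) h3
  rw [Finset.sum_union hF] at h2
  rw [Real.dist_eq, abs_lt] at h1
  linarith [h1.2]

end Kernels

/-! ### Divided differences and eigenvectors in the functional calculus. -/

section OperatorBasics

variable {H : Type*} [NormedAddCommGroup H] [InnerProductSpace ℂ H] [CompleteSpace H]

theorem mem_selfAdjointWithSpectrumIn_Icc {m M : ℝ} {A : H →L[ℂ] H} :
    A ∈ selfAdjointWithSpectrumIn H (Icc m M) ↔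
      IsSelfAdjoint A ∧ algebraMap ℝ (H →L[ℂ] H) m ≤ A ∧ A ≤ algebraMap ℝ (H →L[ℂ] H) M := by
  refine and_congr_right fun hA => ?_
  rw [algebraMap_le_iff_le_spectrum hA, le_algebraMap_iff_spectrum_le hA]
  exact ⟨fun h => ⟨fun x hx => (h hx).1, fun x hx => (h hx).2⟩, fun h x hx => ⟨h.1 x hx, h.2 x hx⟩⟩

theorem selfAdjointWithSpectrumIn_mono {I J : Set ℝ} (h : I ⊆ J) :
    selfAdjointWithSpectrumIn H I ⊆ selfAdjointWithSpectrumIn H J :=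
  fun _ hA => ⟨hA.1, hA.2.trans h⟩

theorem arithMean_mem_Icc {m M : ℝ} {A B : H →L[ℂ] H}
    (hA : A ∈ selfAdjointWithSpectrumIn H (Icc m M))
    (hB : B ∈ selfAdjointWithSpectrumIn H (Icc m M)) {t : ℝ} (ht : t ∈ Icc (0 : ℝ) 1) :
    arithMean A B t ∈ selfAdjointWithSpectrumIn H (Icc m M) := by
  rw [mem_selfAdjointWithSpectrumIn_Icc] at *
  have h1 : 0 ≤ 1 - t := sub_nonneg.2 ht.2
  refine ⟨((IsSelfAdjoint.all (1 - t)).smul hA.1).add ((IsSelfAdjoint.all t).smul hB.1), ?_, ?_⟩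
  · calc algebraMap ℝ (H →L[ℂ] H) m
        = (1 - t) • algebraMap ℝ (H →L[ℂ] H) m + t • algebraMap ℝ (H →L[ℂ] H) m := by module
      _ ≤ arithMean A B t := add_le_add (smul_le_smul_of_nonneg_left hA.2.1 h1)
          (smul_le_smul_of_nonneg_left hB.2.1 ht.1)
  · calc arithMean A B t
        ≤ (1 - t) • algebraMap ℝ (H →L[ℂ] H) M + t • algebraMap ℝ (H →L[ℂ] H) M :=
          add_le_add (smul_le_smul_of_nonneg_left hA.2.2 h1)
          (smul_le_smul_of_nonneg_left hB.2.2 ht.1)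
      _ = algebraMap ℝ (H →L[ℂ] H) M := by module

variable {f : ℝ → ℝ} {k : ℝ → ℝ → ℝ}

theorem cfc_eq_add_sub_mul_cfc (hk : Continuous (Function.uncurry k))
    (hfk : ∀ x y, f x - f y = (x - y) * k x y) (x : ℝ) {B : H →L[ℂ] H} (hB : IsSelfAdjoint B) :
    cfc f B = algebraMap ℝ (H →L[ℂ] H) (f x) + (B - algebraMap ℝ (H →L[ℂ] H) x) * cfc (k x) B := by
  have hkx : Continuous (k x) := hk.comp (continuous_const.prodMk continuous_id)
  have h1 : f = fun y => f x + (y - x) * k x y := by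
    ext y; linarith [hfk x y]
  conv_lhs => rw [h1]
  rw [cfc_const_add (f x) (fun y => (y - x) * k x y) B,
    cfc_mul (fun y : ℝ => y - x) (k x) B, cfc_sub (fun y : ℝ => y) (fun _ => x) B,
    cfc_const x B, cfc_id' ℝ B]

/-- The functional calculus acts on eigenvectors by evaluation. -/
theorem cfc_apply_eigenvector {g : ℝ → ℝ} (hg : Continuous g) {x : ℝ} {A : H →L[ℂ] H}
    (hA : IsSelfAdjoint A) {e : H} (he : A e = x • e) : cfc g A e = g x • e := by
  -- The interval must contain `x` separately, since `e = 0` is allowed and `x` may then lie off the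
  -- spectrum.
  obtain ⟨R, hR, hxR⟩ : ∃ R : ℝ, spectrum ℝ A ⊆ Icc (-R) R ∧ x ∈ Icc (-R) R := by
    refine ⟨max (‖A‖ * ‖(1 : H →L[ℂ] H)‖) |x|, fun y hy => ?_, ?_⟩
    · have := spectrum.subset_closedBall_norm_mul (𝕜 := ℝ) A hy
      rw [mem_closedBall_zero_iff, Real.norm_eq_abs] at this
      exact abs_le.1 (this.trans (le_max_left _ _))
    · exact abs_le.1 (le_max_right _ _)
  have hpoly : ∀ p : Polynomial ℝ, Polynomial.aeval A p e = p.eval x • e := by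
    intro p
    obtain ⟨q, hq⟩ := Polynomial.X_sub_C_dvd_sub_C_eval (p := p) (a := x)
    have h1 : p = q * (Polynomial.X - Polynomial.C x) + Polynomial.C (p.eval x) := by
      rw [mul_comm, ← hq, sub_add_cancel]
    conv_lhs => rw [h1]
    simp [Algebra.algebraMap_eq_smul_one, he]
  refine eq_of_norm_sub_le_zero (le_of_forall_pos_le_add fun ε hε => ?_)
  obtain ⟨p, hp⟩ := exists_polynomial_near_of_continuousOn (-R) R g hg.continuousOn
    (ε / (2 * (‖e‖ + 1))) (by positivity)
  have h1 : ‖cfc g A - cfc (fun y => p.eval y) A‖ ≤ ε / (2 * (‖e‖ + 1)) := by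
    rw [← cfc_sub g (fun y => p.eval y) A]
    refine norm_cfc_le (by positivity) fun y hy => ?_
    rw [norm_sub_rev]
    exact (hp y (hR hy)).le
  have h2 : cfc (fun y => p.eval y) A e = p.eval x • e := by
    rw [cfc_polynomial p A, hpoly]
  have h3 : cfc g A e - g x • e
      = (cfc g A - cfc (fun y => p.eval y) A) e + (p.eval x - g x) • e := by
    rw [_root_.sub_apply, h2]; module
  rw [h3, zero_add]
  calc ‖(cfc g A - cfc (fun y => p.eval y) A) e + (p.eval x - g x) • e‖
      ≤ ε / (2 * (‖e‖ + 1)) * ‖e‖ + ε / (2 * (‖e‖ + 1)) * ‖e‖ := by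
        refine (norm_add_le _ _).trans (add_le_add (ContinuousLinearMap.le_of_opNorm_le _ h1 _) ?_)
        rw [norm_smul]
        gcongr
        exact (hp x hxR).le
    _ = ε * (‖e‖ / (‖e‖ + 1)) := by field_simp; ring
    _ ≤ ε * 1 := by
        gcongr
        exact (div_le_one (by positivity)).2 (by linarith)
    _ = ε := mul_one ε

/-- Against an eigenvector `A` acts as the scalar `x`, which commutes with `B`. The scalar
divided-difference identity thus survives although `A` and `B` need not commute. -/
theorem inner_cfc_sub_cfc_of_eigenvector (hf : Continuous f) (hk : Continuous (Function.uncurry k))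
    (hfk : ∀ x y, f x - f y = (x - y) * k x y) {x : ℝ} {A B : H →L[ℂ] H} (hA : IsSelfAdjoint A)
    (hB : IsSelfAdjoint B) {e : H} (he : A e = x • e) (η : H) :
    inner ℂ e ((cfc f B - cfc f A) η) = inner ℂ e (((B - A) * cfc (k x) B) η) := by
  have hfA : IsSelfAdjoint (cfc f A) := cfc_predicate _ _
  have h1 : inner ℂ e (cfc f A η) = inner ℂ e (f x • η) := by
    rw [← ContinuousLinearMap.adjoint_inner_left, hfA.adjoint_eq,
      cfc_apply_eigenvector hf hA he, inner_smul_left_eq_smul, inner_smul_right_eq_smul]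
  have h2 : ∀ ζ, inner ℂ e (A ζ) = inner ℂ e (x • ζ) := fun ζ => by
    rw [← ContinuousLinearMap.adjoint_inner_left, hA.adjoint_eq, he, inner_smul_left_eq_smul,
      inner_smul_right_eq_smul]
  rw [_root_.sub_apply, inner_sub_right, h1, ← inner_sub_right,
    cfc_eq_add_sub_mul_cfc hk hfk x hB, mul_apply_eq_comp]
  simp [Algebra.algebraMap_eq_smul_one, sub_mul, inner_sub_right, h2]
  rw [inner_smul_right_eq_smul, Complex.real_smul]

theorem exists_diagonal {ι : Type*} [Fintype ι] {e : ι → H} (he : Orthonormal ℂ e) {m M : ℝ}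
    (hmM : m ≤ M) {x : ι → ℝ} (hx : ∀ i, x i ∈ Icc m M) :
    ∃ A ∈ selfAdjointWithSpectrumIn H (Icc m M), ∀ i, A (e i) = x i • e i := by
  classical
  let P : ι → H →L[ℂ] H := fun i => InnerProductSpace.rankOne ℂ (e i) (e i)
  have hP : ∀ i, 0 ≤ P i := fun i => (InnerProductSpace.isStarProjection_rankOne_self (he.1 i)).nonneg
  have hPsa : ∀ i, IsSelfAdjoint (P i) := fun i => .of_nonneg (hP i)
  have hsum : ∑ i, P i ≤ 1 := by
    rw [ContinuousLinearMap.le_def, ContinuousLinearMap.isPositive_def']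
    refine ⟨(IsSelfAdjoint.one _).sub (isSelfAdjoint_sum _ fun i _ => hPsa i), fun ξ => ?_⟩
    have := he.sum_inner_products_le ξ (s := Finset.univ)
    simp only [ContinuousLinearMap.reApplyInnerSelf_apply, P, _root_.sub_apply, _root_.sum_apply,
      InnerProductSpace.rankOne_apply, inner_sub_left, sum_inner, inner_smul_left,
      one_apply_eq_self, map_sub, map_sum, inner_self_eq_norm_sq]
    refine sub_nonneg.2 (le_trans (le_of_eq ?_) this)
    refine Finset.sum_congr rfl fun i _ => ?_
    rw [RCLike.conj_mul]
    norm_cast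
  -- The operator is the scalar `m` on the complement of the span, so its spectrum stays in `[m,
  -- M]`.
  refine ⟨algebraMap ℝ _ m + ∑ i, (x i - m) • P i, ?_, fun i => ?_⟩
  · rw [mem_selfAdjointWithSpectrumIn_Icc]
    refine ⟨(IsSelfAdjoint.algebraMap _ (IsSelfAdjoint.all m)).add
      (isSelfAdjoint_sum _ fun i _ => (IsSelfAdjoint.all _).smul (hPsa i)), ?_, ?_⟩
    · exact le_add_of_nonneg_right
        (Finset.sum_nonneg fun i _ => smul_nonneg (sub_nonneg.2 (hx i).1) (hP i))
    · calc algebraMap ℝ (H →L[ℂ] H) m + ∑ i, (x i - m) • P i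
          ≤ algebraMap ℝ (H →L[ℂ] H) m + ∑ i, (M - m) • P i := by
            gcongr with i
            · exact hP i
            · exact (hx i).2
        _ ≤ algebraMap ℝ (H →L[ℂ] H) m + (M - m) • (1 : H →L[ℂ] H) := by
            rw [← Finset.smul_sum]
            refine add_le_add_right ?_ _
            exact smul_le_smul_of_nonneg_left hsum (sub_nonneg.2 hmM)
        _ = algebraMap ℝ (H →L[ℂ] H) M := by
            simp only [Algebra.algebraMap_eq_smul_one]; module
  · simp [P, Algebra.algebraMap_eq_smul_one, orthonormal_iff_ite.1 he, sub_smul]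

end OperatorBasics

/-! ### Averages over opposite rotations and their second order expansion. -/

section Rotation

variable {H : Type*} [NormedAddCommGroup H] [InnerProductSpace ℂ H] [CompleteSpace H]

/-- The average of the conjugates of `T` by the rotations `1 + κ Z² ± s Z`, where `Z` is a skew
partial isometry and `κ = 1 - √(1 - s²)`. -/
noncomputable def rotationMean (Z T : H →L[ℂ] H) (s : ℝ) : H →L[ℂ] H :=
  (1 + (1 - √(1 - s ^ 2)) • (Z * Z)) * T * (1 + (1 - √(1 - s ^ 2)) • (Z * Z))
    - s ^ 2 • (Z * T * Z)

/-- The second order coefficient of `rotationMean`. -/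
noncomputable def rotationHessian (Z T : H →L[ℂ] H) : H →L[ℂ] H :=
  (1 / 2 : ℝ) • (Z * Z * T + T * (Z * Z)) - Z * T * Z

/-- With `s = sin θ` and `κ = 1 - cos θ` the element is `exp (θ Z)`. The relation `Z³ = -Z`
collapses `U* U` to `1 - (κ² - 2κ + s²) Z²`. -/
theorem rotation_mem_unitary {Z : H →L[ℂ] H} (hZ : star Z = -Z) (hZ3 : Z * Z * Z = -Z) {κ s : ℝ}
    (hκ : κ ^ 2 - 2 * κ + s ^ 2 = 0) : 1 + κ • (Z * Z) + s • Z ∈ unitary (H →L[ℂ] H) := by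
  have h4 : Z * Z * (Z * Z) = -(Z * Z) := by rw [← mul_assoc, hZ3, neg_mul]
  have h3 : Z * (Z * Z) = -Z := by rw [← mul_assoc, hZ3]
  have hs : star (1 + κ • (Z * Z) + s • Z) = 1 + κ • (Z * Z) - s • Z := by
    simp [star_add, star_smul, hZ, sub_eq_add_neg]
  have hcoef : ∀ W : H →L[ℂ] H, (κ ^ 2 - 2 * κ + s ^ 2) • W = 0 := fun W => by rw [hκ, zero_smul]
  rw [Unitary.mem_iff, hs]
  constructor
  · have : (1 + κ • (Z * Z) - s • Z) * (1 + κ • (Z * Z) + s • Z)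
        = 1 - (κ ^ 2 - 2 * κ + s ^ 2) • (Z * Z) := by
      simp only [add_mul, mul_add, sub_mul, one_mul, mul_one, smul_mul_assoc,
        mul_smul_comm, h4, h3, hZ3]
      module
    rw [this, hcoef, sub_zero]
  · have : (1 + κ • (Z * Z) + s • Z) * (1 + κ • (Z * Z) - s • Z)
        = 1 - (κ ^ 2 - 2 * κ + s ^ 2) • (Z * Z) := by
      simp only [add_mul, mul_add, mul_sub, one_mul, mul_one, smul_mul_assoc,
        mul_smul_comm, h4, h3, hZ3]
      module
    rw [this, hcoef, sub_zero]

theorem cfc_unitary_conj {f : ℝ → ℝ} (hf : Continuous f) {A : H →L[ℂ] H} (hA : IsSelfAdjoint A)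
    {U : H →L[ℂ] H} (hU : U ∈ unitary (H →L[ℂ] H)) :
    cfc f (U * A * star U) = U * cfc f A * star U := by
  have h := StarAlgHomClass.map_cfc (S := ℝ) (R := ℝ) (p := IsSelfAdjoint) (q := IsSelfAdjoint)
    (Unitary.conjStarAlgAut ℝ (H →L[ℂ] H) ⟨U, hU⟩) f A (by fun_prop)
    (show Continuous fun x => U * x * star U by fun_prop) hA
    (hA.map (Unitary.conjStarAlgAut ℝ (H →L[ℂ] H) ⟨U, hU⟩))
  simpa only [Unitary.conjStarAlgAut_apply] using h.symm

theorem unitary_conj_mem {I : Set ℝ} {A : H →L[ℂ] H} (hA : A ∈ selfAdjointWithSpectrumIn H I)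
    {U : H →L[ℂ] H} (hU : U ∈ unitary (H →L[ℂ] H)) :
    U * A * star U ∈ selfAdjointWithSpectrumIn H I := by
  refine ⟨hA.1.map (Unitary.conjStarAlgAut ℝ (H →L[ℂ] H) ⟨U, hU⟩), ?_⟩
  have := AlgEquiv.spectrum_eq (Unitary.conjStarAlgAut ℝ (H →L[ℂ] H) ⟨U, hU⟩) A
  exact this.subset.trans hA.2

/-- The two conjugates differ by the sign of `s`, so their midpoint loses the first order term. This
is why `s ^ 2` is the right scale below. -/
theorem rotationMean_eq {Z : H →L[ℂ] H} (hZ : star Z = -Z) (T : H →L[ℂ] H) (s : ℝ) :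
    rotationMean Z T s = arithMean
      ((1 + (1 - √(1 - s ^ 2)) • (Z * Z) + s • Z) * T
        * star (1 + (1 - √(1 - s ^ 2)) • (Z * Z) + s • Z))
      ((1 + (1 - √(1 - s ^ 2)) • (Z * Z) + (-s) • Z) * T
        * star (1 + (1 - √(1 - s ^ 2)) • (Z * Z) + (-s) • Z)) (1 / 2) := by
  unfold rotationMean
  generalize 1 - √(1 - s ^ 2) = κ
  have hs : ∀ r : ℝ, star (1 + κ • (Z * Z) + r • Z) = 1 + κ • (Z * Z) - r • Z := fun r => by
    simp [star_add, star_smul, hZ, sub_eq_add_neg]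
  simp only [arithMean, hs]
  generalize 1 + κ • (Z * Z) = V
  simp only [add_mul, mul_sub, smul_mul_assoc, mul_smul_comm]
  module

theorem rotation_coeff {s : ℝ} (hs : s ^ 2 ≤ 1) :
    (1 - √(1 - s ^ 2)) ^ 2 - 2 * (1 - √(1 - s ^ 2)) + s ^ 2 = 0 := by
  nlinarith [Real.sq_sqrt (sub_nonneg.2 hs)]

theorem rotationMean_mem {Z : H →L[ℂ] H} (hZ : star Z = -Z) (hZ3 : Z * Z * Z = -Z) {m M : ℝ}
    {A : H →L[ℂ] H} (hA : A ∈ selfAdjointWithSpectrumIn H (Icc m M)) {s : ℝ} (hs : s ^ 2 ≤ 1) :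
    rotationMean Z A s ∈ selfAdjointWithSpectrumIn H (Icc m M) := by
  rw [rotationMean_eq hZ]
  exact arithMean_mem_Icc (unitary_conj_mem hA (rotation_mem_unitary hZ hZ3 (rotation_coeff hs)))
    (unitary_conj_mem hA (rotation_mem_unitary hZ hZ3 (by rw [neg_sq]; exact rotation_coeff hs)))
    ⟨by norm_num, by norm_num⟩

theorem cfc_rotationMean_le {Z : H →L[ℂ] H} (hZ : star Z = -Z) (hZ3 : Z * Z * Z = -Z) {m M : ℝ}
    {f : ℝ → ℝ} (hf : Continuous f) (hconv : OperatorConvexOn H (Icc m M) f)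
    {A : H →L[ℂ] H} (hA : A ∈ selfAdjointWithSpectrumIn H (Icc m M)) {s : ℝ} (hs : s ^ 2 ≤ 1) :
    cfc f (rotationMean Z A s) ≤ rotationMean Z (cfc f A) s := by
  have hU := rotation_mem_unitary hZ hZ3 (rotation_coeff hs)
  have hU' := rotation_mem_unitary hZ hZ3 (κ := 1 - √(1 - s ^ 2)) (s := -s)
    (by rw [neg_sq]; exact rotation_coeff hs)
  rw [rotationMean_eq hZ, rotationMean_eq hZ, ← cfc_unitary_conj hf hA.1 hU,
    ← cfc_unitary_conj hf hA.1 hU']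
  exact hconv.2 _ (unitary_conj_mem hA hU) _ (unitary_conj_mem hA hU') _ ⟨by norm_num, by norm_num⟩

theorem tendsto_rotation_coeff :
    Tendsto (fun s : ℝ => (s ^ 2)⁻¹ * (1 - √(1 - s ^ 2))) (𝓝[>] 0) (𝓝 (1 / 2)) := by
  have h : Tendsto (fun s : ℝ => (1 + √(1 - s ^ 2))⁻¹) (𝓝[>] 0) (𝓝 (1 / 2)) := by
    have : ContinuousAt (fun s : ℝ => (1 + √(1 - s ^ 2))⁻¹) 0 := by
      refine ContinuousAt.inv₀ (by fun_prop) (by simp)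
    have h := this.tendsto.mono_left (nhdsWithin_le_nhds (s := Ioi 0))
    convert! h using 2
    norm_num
  refine h.congr' ?_
  have h1 : ∀ᶠ s : ℝ in 𝓝[>] 0, s ∈ Ioo (0 : ℝ) 1 := Ioo_mem_nhdsGT one_pos
  filter_upwards [h1] with s hs
  have hs2 : 0 ≤ 1 - s ^ 2 := by nlinarith [hs.1, hs.2]
  have hs0 : s ^ 2 ≠ 0 := pow_ne_zero _ hs.1.ne'
  have : 1 + √(1 - s ^ 2) ≠ 0 := by positivity
  rw [inv_eq_iff_eq_inv, mul_inv, inv_inv]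
  have h2 : s ^ 2 = (1 - √(1 - s ^ 2)) * (1 + √(1 - s ^ 2)) := by
    nlinarith [Real.sq_sqrt hs2]
  have h3 : 1 - √(1 - s ^ 2) ≠ 0 := fun h => by rw [h, zero_mul] at h2; exact hs0 h2
  field_simp
  linarith

theorem tendsto_rotationMean_sub (Z T : H →L[ℂ] H) :
    Tendsto (fun s : ℝ => (s ^ 2)⁻¹ • (rotationMean Z T s - T)) (𝓝[>] 0)
      (𝓝 (rotationHessian Z T)) := by
  have hκ : Tendsto (fun s : ℝ => 1 - √(1 - s ^ 2)) (𝓝[>] 0) (𝓝 0) := by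
    have : ContinuousAt (fun s : ℝ => 1 - √(1 - s ^ 2)) 0 := by fun_prop
    have h := this.tendsto.mono_left (nhdsWithin_le_nhds (s := Ioi 0))
    convert! h using 2
    simp
  have h1 := ((tendsto_rotation_coeff.smul_const (Z * Z * T + T * (Z * Z))).add
    ((tendsto_rotation_coeff.mul hκ).smul_const (Z * Z * T * (Z * Z)))).sub_const (Z * T * Z)
  rw [mul_zero, zero_smul, add_zero] at h1
  refine h1.congr' ?_
  filter_upwards [self_mem_nhdsWithin] with s hs
  have hs0 : (s ^ 2)⁻¹ * s ^ 2 = 1 := inv_mul_cancel₀ (pow_ne_zero _ (ne_of_gt hs))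
  simp only [rotationMean]
  generalize 1 - √(1 - s ^ 2) = κ
  simp only [add_mul, mul_add, one_mul, mul_one, smul_mul_assoc, mul_smul_comm]
  have h3 : (s ^ 2)⁻¹ • (s ^ 2 • (Z * T * Z)) = Z * T * Z := by rw [smul_smul, hs0, one_smul]
  conv_lhs => rw [← h3]
  module

theorem tendsto_rotationMean (Z T : H →L[ℂ] H) :
    Tendsto (fun s : ℝ => rotationMean Z T s) (𝓝[>] 0) (𝓝 T) := by
  have : Continuous fun s : ℝ => rotationMean Z T s := by
    unfold rotationMean; fun_prop
  have h := (this.tendsto 0).mono_left (nhdsWithin_le_nhds (s := Ioi 0))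
  convert! h using 2
  simp [rotationMean]

end Rotation

/-! ### Positivity of the curvature kernel. -/

section CurvatureKernel

/-- The kernel `(x - c) (y - c) f[x, c, y]` written through the first divided difference `k` of
`f`. -/
noncomputable def curvatureKernel (f : ℝ → ℝ) (k : ℝ → ℝ → ℝ) (c x y : ℝ) : ℝ :=
  ((x + y) / 2 - c) * k x y - ((f x + f y) / 2 - f c)

variable {H : Type*} [NormedAddCommGroup H] [InnerProductSpace ℂ H] [CompleteSpace H]

/-- The generator of the rotation in the plane spanned by two orthonormal vectors. -/
noncomputable def planeGenerator (a b : H) : H →L[ℂ] H :=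
  InnerProductSpace.rankOne ℂ a b - InnerProductSpace.rankOne ℂ b a

theorem star_planeGenerator (a b : H) : star (planeGenerator a b) = -planeGenerator a b := by
  simp [planeGenerator, ContinuousLinearMap.star_eq_adjoint]

theorem planeGenerator_apply {E : Type*} [NormedAddCommGroup E] [InnerProductSpace ℂ E]
    (a b ξ : E) :
    planeGenerator a b ξ = inner ℂ b ξ • a - inner ℂ a ξ • b := by
  simp [planeGenerator]

theorem planeGenerator_cube {E : Type*} [NormedAddCommGroup E] [InnerProductSpace ℂ E] {a b : E}
    (ha : ‖a‖ = 1) (hb : ‖b‖ = 1) (hab : inner ℂ a b = 0) :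
    planeGenerator a b * planeGenerator a b * planeGenerator a b = -planeGenerator a b := by
  have hba : inner ℂ b a = 0 := inner_eq_zero_symm.1 hab
  have haa : inner ℂ a a = 1 := by simp [inner_self_eq_norm_sq_to_K, ha]
  have hbb : inner ℂ b b = 1 := by simp [inner_self_eq_norm_sq_to_K, hb]
  ext ξ
  simp only [mul_apply_eq_comp, planeGenerator_apply, _root_.neg_apply, inner_sub_right,
    inner_smul_right, hab, hba, haa, hbb]
  module

/-- The terms `Z²T` and `TZ²` produce `t` and `t'`, and `ZTZ` produces `r`. Because `a` has the same
overlap `α` with both vectors, the entry depends on them only through their eigenvalues. -/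
theorem inner_rotationHessian_apply {a b e e' : H} {T : H →L[ℂ] H} (hT : IsSelfAdjoint T)
    (hb : ‖b‖ = 1) (hab : inner ℂ a b = 0)
    (heb' : inner ℂ e' b = 0) {α t t' r : ℝ} (hae : inner ℂ a e = α) (hae' : inner ℂ a e' = α)
    (hTe : T e = t • e) (hTe' : T e' = t' • e') (hTb : T b = r • b) :
    inner ℂ e (rotationHessian (planeGenerator a b) T e')
      = ((α ^ 2 * (r - (t + t') / 2) : ℝ) : ℂ) := by
  have hbb : inner ℂ b b = 1 := by simp [inner_self_eq_norm_sq_to_K, hb]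
  have hbe' : inner ℂ b e' = 0 := inner_eq_zero_symm.1 heb'
  have hea : inner ℂ e a = α := by rw [← inner_conj_symm, hae, Complex.conj_ofReal]
  have heTa : inner ℂ e (T a) = t * α := by
    rw [← ContinuousLinearMap.adjoint_inner_left, hT.adjoint_eq, hTe, inner_smul_left_eq_smul, hea,
      Complex.real_smul]
  have hZ' : planeGenerator a b e' = -((α : ℂ) • b) := by
    simp [planeGenerator_apply, hbe', hae']
  have hZb : planeGenerator a b b = a := by
    rw [planeGenerator_apply, hbb, hab, one_smul, zero_smul, sub_zero]
  have hrs : ∀ (c : ℝ) (v : H), c • v = (c : ℂ) • v := fun c v => (Complex.coe_smul c v).symm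
  simp only [rotationHessian, _root_.sub_apply, _root_.smul_apply, _root_.add_apply,
    mul_apply_eq_comp, hTe', hZ', hrs, map_smul, map_neg, hTb, hZb, inner_sub_right,
    inner_add_right, inner_smul_right, inner_neg_right, hea, heTa]
  push_cast
  ring

variable {f : ℝ → ℝ} {k : ℝ → ℝ → ℝ}

/-- Testing against an eigenvector needs only norm continuity of `cfc (k x)`, so no operator
differentiability of `f` is presupposed. -/
theorem tendsto_inner_cfc_rotationMean_sub (hf : Continuous f) (hk : Continuous (Function.uncurry k))
    (hfk : ∀ x y, f x - f y = (x - y) * k x y) {Z : H →L[ℂ] H} (hZ : star Z = -Z)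
    (hZ3 : Z * Z * Z = -Z) {m M : ℝ} {A : H →L[ℂ] H}
    (hA : A ∈ selfAdjointWithSpectrumIn H (Icc m M)) {x : ℝ} {e : H} (he : A e = x • e) (η : H) :
    Tendsto (fun s : ℝ => inner ℂ e (((s ^ 2)⁻¹ • (cfc f (rotationMean Z A s) - cfc f A)) η))
      (𝓝[>] 0) (𝓝 (inner ℂ e (rotationHessian Z A (cfc (k x) A η)))) := by
  have hkx : Continuous (k x) := hk.comp (continuous_const.prodMk continuous_id)
  have hsmall : ∀ᶠ s : ℝ in 𝓝[>] 0, s ^ 2 ≤ 1 := by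
    have h1 : ∀ᶠ s : ℝ in 𝓝[>] 0, s ∈ Ioo (0 : ℝ) 1 := Ioo_mem_nhdsGT one_pos
    filter_upwards [h1] with s hs
    nlinarith [hs.1, hs.2]
  have hmem : ∀ᶠ s : ℝ in 𝓝[>] 0,
      rotationMean Z A s ∈ selfAdjointWithSpectrumIn H (Icc m M) :=
    hsmall.mono fun s hs => rotationMean_mem hZ hZ3 hA hs
  have h1 : Tendsto (fun s : ℝ => cfc (k x) (rotationMean Z A s)) (𝓝[>] 0) (𝓝 (cfc (k x) A)) :=
    (tendsto_rotationMean Z A).cfc isCompact_Icc (k x) (hmem.mono fun s hs => hs.2)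
      (hmem.mono fun s hs => hs.1) hA.2 hA.1
  have h2 := (tendsto_rotationMean_sub Z A).mul h1
  have h3 := (((innerSL ℂ e).comp (ContinuousLinearMap.apply ℂ H η)).continuous.tendsto _).comp h2
  simp only [ContinuousLinearMap.comp_apply, ContinuousLinearMap.apply_apply,
    innerSL_apply_apply, mul_apply_eq_comp] at h3
  refine h3.congr' ?_
  filter_upwards [hmem] with s hs
  simp only [Function.comp, ContinuousLinearMap.comp_apply, ContinuousLinearMap.apply_apply,
    innerSL_apply_apply, smul_mul_assoc, _root_.smul_apply]
  rw [inner_smul_right_eq_smul, inner_smul_right_eq_smul,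
    inner_cfc_sub_cfc_of_eigenvector hf hk hfk hA.1 hs.1 he η]

/-- Compare the `s ^ 2` coefficients of `f(mean of A) ≤ mean of f(A)` at the vector with coordinates
`η`. The rotation plane is spanned by the eigenvector for `c` and the normalized sum of the others.
-/
theorem sum_curvatureKernel_nonneg (hk : Continuous (Function.uncurry k))
    (hfk : ∀ x y, f x - f y = (x - y) * k x y) (hf : Continuous f) {m M : ℝ}
    (hconv : OperatorConvexOn H (Icc m M) f) {ι : Type*} [Fintype ι] {e : Option ι → H}
    (he : Orthonormal ℂ e) {x : ι → ℝ} (hx : ∀ i, x i ∈ Icc m M) {c : ℝ} (hc : c ∈ Icc m M)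
    (η : ι → ℝ) : 0 ≤ ∑ i, ∑ j, η i * η j * curvatureKernel f k c (x i) (x j) := by
  classical
  rcases isEmpty_or_nonempty ι with hι | hι
  · simp
  obtain ⟨A, hA, hAe⟩ := exists_diagonal he (hc.1.trans hc.2) (x := fun o => o.elim c x)
    (by rintro (_ | i); exacts [hc, hx i])
  have hA0 : A (e none) = c • e none := hAe none
  have hAi : ∀ i, A (e (some i)) = x i • e (some i) := fun i => hAe (some i)
  have heo := orthonormal_iff_ite.1 he
  -- This value makes `a` a unit vector, as required for `Z³ = -Z`.
  set α : ℝ := (√(Fintype.card ι))⁻¹ with hα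
  have hα0 : 0 < α := by have := Fintype.card_pos (α := ι); positivity
  have hα2 : (Fintype.card ι : ℝ) * α ^ 2 = 1 := by
    have := Fintype.card_pos (α := ι)
    rw [hα, inv_pow, Real.sq_sqrt (by positivity), mul_inv_cancel₀ (by positivity)]
  set a : H := ∑ i, (α : ℂ) • e (some i) with ha
  have hae : ∀ i, inner ℂ a (e (some i)) = α := fun i => by
    simp [ha, heo]
  have hab : inner ℂ a (e none) = 0 := by
    simp [ha, heo]
  have haa : ‖a‖ = 1 := by
    have h1 : inner ℂ a a = ((Fintype.card ι * α ^ 2 : ℝ) : ℂ) := by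
      conv_lhs => rw [ha, inner_sum]
      simp only [← ha, inner_smul_right, hae, Finset.sum_const, Finset.card_univ]
      push_cast; rw [nsmul_eq_mul]; ring
    rw [hα2, inner_self_eq_norm_sq_to_K] at h1
    have h2 : ‖a‖ ^ 2 = 1 := by
      simp only [Complex.coe_algebraMap] at h1
      exact_mod_cast h1
    nlinarith [norm_nonneg a]
  set Z := planeGenerator a (e none) with hZdef
  have hZ : star Z = -Z := star_planeGenerator _ _
  have hZ3 : Z * Z * Z = -Z := planeGenerator_cube haa (he.1 none) hab
  set v : H := ∑ i, (η i : ℂ) • e (some i) with hv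
  have hfA : IsSelfAdjoint (cfc f A) := cfc_predicate _ _
  have hkx : ∀ i, Continuous (k (x i)) := fun i => hk.comp (continuous_const.prodMk continuous_id)
  have hentry : ∀ {T : H →L[ℂ] H} {r : ℝ} {t : ι → ℝ}, IsSelfAdjoint T → T (e none) = r • e none →
      (∀ i, T (e (some i)) = t i • e (some i)) → ∀ i j,
      inner ℂ (e (some i)) (rotationHessian Z T (e (some j)))
        = ((α ^ 2 * (r - (t i + t j) / 2) : ℝ) : ℂ) := by
    intro T r t hT h0 ht i j
    exact inner_rotationHessian_apply hT (he.1 none) hab (by simp [heo])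
      (hae i) (hae j) (ht i) (ht j) h0
  have hleft : Tendsto (fun s : ℝ =>
      Complex.re (inner ℂ v (((s ^ 2)⁻¹ • (cfc f (rotationMean Z A s) - cfc f A)) v))) (𝓝[>] 0)
      (𝓝 (∑ i, ∑ j, η i * η j * (k (x i) (x j) * (α ^ 2 * (c - (x i + x j) / 2))))) := by
    have h1 : Tendsto (fun s : ℝ =>
        ∑ i, η i * Complex.re (inner ℂ (e (some i))
          (((s ^ 2)⁻¹ • (cfc f (rotationMean Z A s) - cfc f A)) v))) (𝓝[>] 0)
        (𝓝 (∑ i, η i * Complex.re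
          (inner ℂ (e (some i)) (rotationHessian Z A (cfc (k (x i)) A v))))) :=
      tendsto_finsetSum _ fun i _ => ((Complex.continuous_re.tendsto _).comp
        (tendsto_inner_cfc_rotationMean_sub hf hk hfk hZ hZ3 hA (hAi i) v)).const_mul _
    convert! h1 using 2
    · rename_i s
      conv_lhs => rw [hv, sum_inner]
      simp only [← hv, inner_smul_left, Complex.conj_ofReal, Complex.re_sum, Complex.re_ofReal_mul]
    · refine Finset.sum_congr rfl fun i _ => ?_
      have hkv : cfc (k (x i)) A v = ∑ j, ((η j * k (x i) (x j) : ℝ) : ℂ) • e (some j) := by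
        rw [hv, map_sum]
        refine Finset.sum_congr rfl fun j _ => ?_
        rw [map_smul, cfc_apply_eigenvector (hkx i) hA.1 (hAi j), ← Complex.coe_smul, smul_smul]
        push_cast
        rfl
      rw [hkv, map_sum, inner_sum, Complex.re_sum, Finset.mul_sum]
      refine Finset.sum_congr rfl fun j _ => ?_
      rw [map_smul, inner_smul_right, hentry hA.1 hA0 hAi, ← Complex.ofReal_mul, Complex.ofReal_re]
      ring
  have hright : Tendsto (fun s : ℝ =>
      Complex.re (inner ℂ v (((s ^ 2)⁻¹ • (rotationMean Z (cfc f A) s - cfc f A)) v))) (𝓝[>] 0)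
      (𝓝 (∑ i, ∑ j, η i * η j * (α ^ 2 * (f c - (f (x i) + f (x j)) / 2)))) := by
    have h1 := ((Complex.reCLM.continuous.comp ((innerSL ℂ v).comp
      (ContinuousLinearMap.apply ℂ H v)).continuous).tendsto _).comp
      (tendsto_rotationMean_sub Z (cfc f A))
    convert! h1 using 2
    have hfi : ∀ i, cfc f A (e (some i)) = f (x i) • e (some i) := fun i =>
      cfc_apply_eigenvector hf hA.1 (hAi i)
    have hf0 : cfc f A (e none) = f c • e none := cfc_apply_eigenvector hf hA.1 hA0
    change _ = Complex.re (inner ℂ v (rotationHessian Z (cfc f A) v))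
    rw [hv]
    simp only [map_sum, map_smul, sum_inner, inner_sum, inner_smul_left, inner_smul_right,
      Complex.conj_ofReal, hentry hfA hf0 hfi]
    simp only [← Complex.ofReal_mul, ← Complex.ofReal_sum, Complex.ofReal_re]
    simp only [Finset.mul_sum]
    refine Finset.sum_congr rfl fun i _ => Finset.sum_congr rfl fun j _ => ?_
    ring
  have hle := le_of_tendsto_of_tendsto hleft hright (by
    have h1 : ∀ᶠ s : ℝ in 𝓝[>] 0, s ∈ Ioo (0 : ℝ) 1 := Ioo_mem_nhdsGT one_pos
    filter_upwards [h1] with s hs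
    have hc := cfc_rotationMean_le hZ hZ3 hf hconv hA (s := s) (by nlinarith [hs.1, hs.2])
    have hle : (s ^ 2)⁻¹ • (cfc f (rotationMean Z A s) - cfc f A)
        ≤ (s ^ 2)⁻¹ • (rotationMean Z (cfc f A) s - cfc f A) :=
      smul_le_smul_of_nonneg_left (sub_le_sub_right hc _) (by positivity)
    rw [ContinuousLinearMap.le_def] at hle
    have := hle.re_inner_nonneg_right v
    rw [_root_.sub_apply, inner_sub_right, map_sub] at this
    exact sub_nonneg.1 this)
  have hmul : α ^ 2 * ∑ i, ∑ j, η i * η j * curvatureKernel f k c (x i) (x j)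
      = (∑ i, ∑ j, η i * η j * (α ^ 2 * (f c - (f (x i) + f (x j)) / 2)))
        - ∑ i, ∑ j, η i * η j * (k (x i) (x j) * (α ^ 2 * (c - (x i + x j) / 2))) := by
    simp only [Finset.mul_sum, ← Finset.sum_sub_distrib, curvatureKernel]
    refine Finset.sum_congr rfl fun i _ => Finset.sum_congr rfl fun j _ => ?_
    ring
  have : 0 ≤ α ^ 2 * ∑ i, ∑ j, η i * η j * curvatureKernel f k c (x i) (x j) := by
    rw [hmul]; exact sub_nonneg.2 hle
  exact nonneg_of_mul_nonneg_right this (by positivity)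

end CurvatureKernel

/-! ### Families with uniformly small square tails. -/

section SquareTails

/-- The square sums of the family `g` have uniformly small tails on `J`. -/
def SmallSquareTails {ι : Type*} (g : ι → ℝ → ℝ) (J : Set ℝ) : Prop :=
  ∀ ε > 0, ∃ F₀ : Finset ι, ∀ F : Finset ι, Disjoint F F₀ → ∀ x ∈ J, ∑ i ∈ F, g i x ^ 2 ≤ ε

variable {ι κ : Type*} {J : Set ℝ}

theorem SmallSquareTails.of_finite [Finite ι] (g : ι → ℝ → ℝ) : SmallSquareTails g J := by
  have := Fintype.ofFinite ι
  refine fun ε hε => ⟨Finset.univ, fun F hF x _ => ?_⟩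
  have : F = ∅ := by
    rwa [← Finset.top_eq_univ, disjoint_top, Finset.bot_eq_empty] at hF
  simpa [this] using hε.le

theorem SmallSquareTails.mul_bounded {g : ι → ℝ → ℝ} (hg : SmallSquareTails g J) {b : ι → ℝ → ℝ}
    {C : ℝ} (hb : ∀ i, ∀ x ∈ J, |b i x| ≤ C) : SmallSquareTails (fun i x => b i x * g i x) J := by
  intro ε hε
  obtain ⟨F₀, hF₀⟩ := hg (ε / (C ^ 2 + 1)) (by positivity)
  refine ⟨F₀, fun F hF x hx => ?_⟩
  calc ∑ i ∈ F, (b i x * g i x) ^ 2 ≤ ∑ i ∈ F, (C ^ 2 + 1) * g i x ^ 2 := by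
        refine Finset.sum_le_sum fun i _ => ?_
        rw [mul_pow]
        refine mul_le_mul_of_nonneg_right ?_ (sq_nonneg _)
        have := pow_le_pow_left₀ (abs_nonneg _) (hb i x hx) 2
        rw [sq_abs] at this
        linarith
    _ = (C ^ 2 + 1) * ∑ i ∈ F, g i x ^ 2 := by rw [Finset.mul_sum]
    _ ≤ (C ^ 2 + 1) * (ε / (C ^ 2 + 1)) := by gcongr; exact hF₀ F hF x hx
    _ = ε := by field_simp

theorem SmallSquareTails.sumElim {g : ι → ℝ → ℝ} {h : κ → ℝ → ℝ} (hg : SmallSquareTails g J)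
    (hh : SmallSquareTails h J) : SmallSquareTails (Sum.elim g h) J := by
  intro ε hε
  obtain ⟨F, hF⟩ := hg (ε / 2) (half_pos hε)
  obtain ⟨G, hG⟩ := hh (ε / 2) (half_pos hε)
  refine ⟨F.disjSum G, fun S hS x hx => ?_⟩
  rw [Finset.sum_sum_eq_sum_toLeft_add_sum_toRight]
  have h1 := hF S.toLeft (Finset.disjoint_left.2 fun i hi hi' =>
    Finset.disjoint_left.1 hS (Finset.mem_toLeft.1 hi) (Finset.inl_mem_disjSum.2 hi')) x hx
  have h2 := hG S.toRight (Finset.disjoint_left.2 fun i hi hi' =>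
    Finset.disjoint_left.1 hS (Finset.mem_toRight.1 hi) (Finset.inr_mem_disjSum.2 hi')) x hx
  simp only [Sum.elim_inl, Sum.elim_inr]
  linarith

theorem SmallSquareTails.exists_bound {g : ι → ℝ → ℝ} (hg : SmallSquareTails g J)
    (hJ : IsCompact J) (hc : ∀ i, Continuous (g i)) :
    ∃ C, ∀ F : Finset ι, ∀ x ∈ J, ∑ i ∈ F, g i x ^ 2 ≤ C := by
  classical
  obtain ⟨F₀, hF₀⟩ := hg 1 one_pos
  obtain ⟨C, hC⟩ := hJ.exists_bound_of_continuousOn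
    (f := fun x => ∑ i ∈ F₀, g i x ^ 2) (by fun_prop)
  refine ⟨C + 1, fun F x hx => ?_⟩
  have h1 := hF₀ (F \ F₀) Finset.sdiff_disjoint x hx
  have h2 := hC x hx
  rw [Real.norm_eq_abs] at h2
  have h3 : ∑ i ∈ F ∩ F₀, g i x ^ 2 ≤ ∑ i ∈ F₀, g i x ^ 2 :=
    Finset.sum_le_sum_of_subset_of_nonneg Finset.inter_subset_right fun _ _ _ => sq_nonneg _
  rw [← Finset.sum_inter_add_sum_sdiff F F₀]
  linarith [le_abs_self (∑ i ∈ F₀, g i x ^ 2)]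

end SquareTails

/-! ### Factorization of the divided difference and of `f(A) - f(B)`. -/

section Factorization

variable {H : Type*} [NormedAddCommGroup H] [InnerProductSpace ℂ H] [CompleteSpace H]

theorem exists_orthonormal_of_infinite (hH : ¬FiniteDimensional ℂ H) (ι : Type*) [Finite ι] :
    ∃ e : ι → H, Orthonormal ℂ e := by
  obtain ⟨w, b, -⟩ := exists_hilbertBasis ℂ H
  have hw : Infinite w := by
    by_contra hfin
    rw [not_infinite_iff_finite] at hfin
    have := Fintype.ofFinite w
    exact hH b.toOrthonormalBasis.toBasis.finiteDimensional_of_finite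
  have := Fintype.ofFinite ι
  let φ : ι ↪ w := (Fintype.equivFin ι).toEmbedding.trans
    (Fin.valEmbedding.trans (Infinite.natEmbedding w))
  exact ⟨b ∘ φ, b.orthonormal.comp φ φ.injective⟩

variable {f : ℝ → ℝ} {k : ℝ → ℝ → ℝ}

theorem dividedDifference_comm (hfk : ∀ x y, f x - f y = (x - y) * k x y) (x y : ℝ) :
    k x y = k y x := by
  rcases eq_or_ne x y with rfl | h
  · rfl
  · have h1 := hfk x y
    have h2 := hfk y x
    exact mul_left_cancel₀ (sub_ne_zero.2 h) (by linarith)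

/-- Positivity on `n` points uses `n + 1` orthonormal vectors, so infinite dimension gives it for
every `n`. -/
theorem exists_curvatureKernel_features (hH : ¬FiniteDimensional ℂ H)
    (hk : Continuous (Function.uncurry k)) (hfk : ∀ x y, f x - f y = (x - y) * k x y)
    (hf : Continuous f) {m M : ℝ} (hconv : OperatorConvexOn H (Icc m M) f) {c : ℝ}
    (hc : c ∈ Icc m M) :
    ∃ (ι : Type) (e : ι → ℝ → ℝ), (∀ i, Continuous (e i)) ∧ SmallSquareTails e (Icc m M) ∧
      ∀ x ∈ Icc m M, ∀ y ∈ Icc m M,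
        HasSum (fun i => e i x * e i y) (curvatureKernel f k c x y) := by
  have hmM : m ≤ M := hc.1.trans hc.2
  -- Clamping to `[m, M]` yields a kernel positive on the whole line; clamped points may coincide,
  -- which the indexed positivity statement allows.
  let π : ℝ → ℝ := fun x => projIcc m M hmM x
  have hπ : Continuous π := continuous_subtype_val.comp continuous_projIcc
  have hπJ : ∀ x, π x ∈ Icc m M := fun x => (projIcc m M hmM x).2
  have hπid : ∀ x ∈ Icc m M, π x = x := fun x hx => by simp [π, projIcc_of_mem hmM hx]
  obtain ⟨ι, e, he, hsum, htail⟩ := exists_continuous_features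
    (K := fun x y => curvatureKernel f k c (π x) (π y))
    (by
      have : Continuous fun p : ℝ × ℝ => k (π p.1) (π p.2) :=
        hk.comp ((hπ.comp continuous_fst).prodMk (hπ.comp continuous_snd))
      simp only [Function.uncurry_def, curvatureKernel]
      fun_prop)
    (fun x y => by
      simp only [curvatureKernel, dividedDifference_comm hfk (π x) (π y)]
      ring)
    (fun s v => by
      obtain ⟨b, hb⟩ := exists_orthonormal_of_infinite hH (Option s)
      have := sum_curvatureKernel_nonneg hk hfk hf hconv hb (x := fun i : s => π i)
        (fun i => hπJ i) hc (fun i => v i)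
      simp only [Finset.univ_eq_attach] at this
      rw [Finset.sum_attach s fun x => ∑ j ∈ s.attach,
        v x * v j * curvatureKernel f k c (π x) (π j)] at this
      refine this.trans_eq (Finset.sum_congr rfl fun x _ => ?_)
      exact Finset.sum_attach s fun y => v x * v y * curvatureKernel f k c (π x) (π y))
    (isCompact_Icc (a := m) (b := M))
  refine ⟨ι, e, he, htail, fun x hx y hy => ?_⟩
  simpa only [hπid x hx, hπid y hy] using hsum x y

/-- In infinite dimension, the first divided difference of an operator convex `C¹` function is an
absolutely convergent sum of products. -/
theorem exists_dividedDifference_factorization (hH : ¬FiniteDimensional ℂ H)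
    (hk : Continuous (Function.uncurry k)) (hfk : ∀ x y, f x - f y = (x - y) * k x y)
    (hf : Continuous f) {m M : ℝ} (hmM : m < M) (hconv : OperatorConvexOn H (Icc m M) f) :
    ∃ (ι : Type) (g h : ι → ℝ → ℝ), (∀ i, Continuous (g i)) ∧ (∀ i, Continuous (h i)) ∧
      SmallSquareTails g (Icc m M) ∧ SmallSquareTails h (Icc m M) ∧
      ∀ x ∈ Icc m M, ∀ y ∈ Icc m M, HasSum (fun i => g i x * h i y) (k x y) := by
  obtain ⟨ι, e, he, hte, hse⟩ := exists_curvatureKernel_features hH hk hfk hf hconv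
    (left_mem_Icc.2 hmM.le)
  obtain ⟨κ, d, hd, htd, hsd⟩ := exists_curvatureKernel_features hH hk hfk hf hconv
    (right_mem_Icc.2 hmM.le)
  have hne : M - m ≠ 0 := (sub_pos.2 hmM).ne'
  -- With `K_c` the curvature kernel, `k = (K_m - K_M + f M - f m) / (M - m)`; signs and scale go
  -- into `h`.
  refine ⟨(ι ⊕ κ) ⊕ Unit, Sum.elim (Sum.elim e d) fun _ _ => 1,
    Sum.elim (Sum.elim (fun i x => (M - m)⁻¹ * e i x) fun i x => -(M - m)⁻¹ * d i x)
      fun _ _ => (M - m)⁻¹ * (f M - f m), ?_, ?_, ?_, ?_, fun x hx y hy => ?_⟩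
  · rintro ((i | i) | i)
    exacts [he i, hd i, continuous_const]
  · rintro ((i | i) | i)
    exacts [(he i).const_mul _, (hd i).const_mul _, continuous_const]
  · exact (hte.sumElim htd).sumElim (.of_finite _)
  · exact ((hte.mul_bounded (b := fun _ _ => (M - m)⁻¹) fun _ _ _ => le_rfl).sumElim
      (htd.mul_bounded (b := fun _ _ => -(M - m)⁻¹) fun _ _ _ => le_rfl)).sumElim (.of_finite _)
  · have h1 := (hse x hx y hy).mul_left (M - m)⁻¹
    have h2 := (hsd x hx y hy).mul_left (-(M - m)⁻¹)
    have h3 : HasSum (fun _ : Unit => (M - m)⁻¹ * (f M - f m)) ((M - m)⁻¹ * (f M - f m)) :=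
      hasSum_unique _
    have hval : k x y = (M - m)⁻¹ * curvatureKernel f k m x y
        + -(M - m)⁻¹ * curvatureKernel f k M x y + (M - m)⁻¹ * (f M - f m) := by
      simp only [curvatureKernel]; field_simp; ring
    rw [hval]
    refine HasSum.sum (HasSum.sum ?_ ?_) ?_
    · simpa only [Function.comp_def, Sum.elim_inl, mul_left_comm] using h1
    · simpa only [Function.comp_def, Sum.elim_inl, Sum.elim_inr, mul_assoc, mul_left_comm] using h2
    · simpa only [Function.comp_def, Sum.elim_inr, one_mul] using h3

/-- If the first divided difference of `f` is `∑ g i x * h i y`, then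
`f(A) - f(B) = ∑ g i (A) (A - B) h i (B)` weakly. -/
theorem hasSum_re_inner_cfc_sub_cfc {ι : Type*} {J : Set ℝ} (hJ : IsCompact J) (hf : Continuous f)
    (hfk : ∀ x y, f x - f y = (x - y) * k x y) {g h : ι → ℝ → ℝ} (hg : ∀ i, Continuous (g i))
    (hh : ∀ i, Continuous (h i)) (hgt : SmallSquareTails g J) (hht : SmallSquareTails h J)
    (hsum : ∀ x ∈ J, ∀ y ∈ J, HasSum (fun i => g i x * h i y) (k x y)) {A B : H →L[ℂ] H}
    (hA : A ∈ selfAdjointWithSpectrumIn H J) (hB : B ∈ selfAdjointWithSpectrumIn H J) (η ξ : H) :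
    HasSum (fun i => Complex.re (inner ℂ η ((cfc (g i) A * (A - B) * cfc (h i) B) ξ)))
      (Complex.re (inner ℂ η ((cfc f A - cfc f B) ξ))) := by
  have hA1 : IsSelfAdjoint A := hA.1
  have hB1 : IsSelfAdjoint B := hB.1
  obtain ⟨C, hC⟩ := hJ.exists_bound_of_continuousOn (f := fun x : ℝ => x) continuousOn_id
  -- The products `p i x * q i y` encode `x k(x, y) - k(x, y) y - f(x) + f(y) = 0`, the operator
  -- variables staying on their own sides.
  let p : (ι ⊕ ι) ⊕ (Unit ⊕ Unit) → ℝ → ℝ :=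
    Sum.elim (Sum.elim (fun i x => x * g i x) g) (Sum.elim (fun _ => f) fun _ _ => 1)
  let q : (ι ⊕ ι) ⊕ (Unit ⊕ Unit) → ℝ → ℝ :=
    Sum.elim (Sum.elim h fun i x => -x * h i x) (Sum.elim (fun _ _ => -1) fun _ => f)
  have hp : ∀ i, Continuous (p i) := by
    rintro ((i | i) | (i | i))
    exacts [continuous_id.mul (hg i), hg i, hf, continuous_const]
  have hq : ∀ i, Continuous (q i) := by
    rintro ((i | i) | (i | i))
    exacts [hh i, continuous_neg.mul (hh i), continuous_const, hf]
  have hpt : SmallSquareTails p J :=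
    ((hgt.mul_bounded (b := fun _ x => x) fun _ x hx => hC x hx).sumElim hgt).sumElim
      ((SmallSquareTails.of_finite _).sumElim (.of_finite _))
  have hqt : SmallSquareTails q J :=
    (hht.sumElim (hht.mul_bounded (b := fun _ x => -x) (C := C) fun _ x hx => by
      rw [abs_neg]; exact hC x hx)).sumElim
      ((SmallSquareTails.of_finite _).sumElim (.of_finite _))
  obtain ⟨Cp, hCp⟩ := hpt.exists_bound hJ hp
  obtain ⟨Cq, hCq⟩ := hqt.exists_bound hJ hq
  have hzero := hasSum_re_inner_cfc_eq_zero hA hB (fun i => (hp i).continuousOn)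
    (fun i => (hq i).continuousOn) hCp hCq (fun x hx y hy => by
      have h1 := (hsum x hx y hy).mul_left x
      have h2 := (hsum x hx y hy).mul_left (-y)
      have h3 : HasSum (fun _ : Unit => -f x) (-f x) := hasSum_unique _
      have h4 : HasSum (fun _ : Unit => f y) (f y) := hasSum_unique _
      have hval : (0 : ℝ) = (x * k x y + -y * k x y) + (-f x + f y) := by linarith [hfk x y]
      rw [hval]
      refine HasSum.sum (HasSum.sum ?_ ?_) (HasSum.sum ?_ ?_)
      · simpa only [Function.comp_def, p, q, Sum.elim_inl, mul_assoc] using h1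
      · simpa only [Function.comp_def, p, q, Sum.elim_inl, Sum.elim_inr, mul_left_comm] using h2
      · simpa only [Function.comp_def, p, q, Sum.elim_inl, Sum.elim_inr, mul_neg, mul_one] using h3
      · simpa only [Function.comp_def, p, q, Sum.elim_inr, one_mul] using h4) η ξ
  set u := fun i => Complex.re (inner ℂ (cfc (p i) A η) (cfc (q i) B ξ)) with hu
  have hsl : Summable (u ∘ Sum.inl) := hzero.summable.comp_injective Sum.inl_injective
  have hs1 : Summable ((u ∘ Sum.inl) ∘ Sum.inl) := hsl.comp_injective Sum.inl_injective
  have hs2 : Summable ((u ∘ Sum.inl) ∘ Sum.inr) := hsl.comp_injective Sum.inr_injective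
  have h3 : HasSum ((u ∘ Sum.inr) ∘ Sum.inl) (u (Sum.inr (Sum.inl ()))) := hasSum_unique _
  have h4 : HasSum ((u ∘ Sum.inr) ∘ Sum.inr) (u (Sum.inr (Sum.inr ()))) := hasSum_unique _
  have htot := HasSum.sum (HasSum.sum hs1.hasSum hs2.hasSum) (HasSum.sum h3 h4)
  have heq := htot.unique hzero
  have hadd := hs1.hasSum.add hs2.hasSum
  have hadj : ∀ {S : H →L[ℂ] H}, IsSelfAdjoint S → ∀ a b : H, inner ℂ (S a) b = inner ℂ a (S b) := by
    intro S hS a b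
    rw [← ContinuousLinearMap.adjoint_inner_right, hS.adjoint_eq]
  have hval : (∑' i, ((u ∘ Sum.inl) ∘ Sum.inl) i) + ∑' i, ((u ∘ Sum.inl) ∘ Sum.inr) i
      = Complex.re (inner ℂ η ((cfc f A - cfc f B) ξ)) := by
    have e3 : u (Sum.inr (Sum.inl ())) = -Complex.re (inner ℂ η (cfc f A ξ)) := by
      simp only [hu, p, q, Sum.elim_inr, Sum.elim_inl]
      rw [hadj (cfc_predicate f A), cfc_const (-1 : ℝ) B]
      simp
    have e4 : u (Sum.inr (Sum.inr ())) = Complex.re (inner ℂ η (cfc f B ξ)) := by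
      simp only [hu, p, q, Sum.elim_inr]
      rw [cfc_const_one ℝ A]
      simp
    rw [_root_.sub_apply, inner_sub_right, Complex.sub_re]
    linarith
  rw [hval] at hadd
  refine hadd.congr_fun ?_ |> fun h => h
  intro i
  simp only [Function.comp_apply, hu, p, q, Sum.elim_inl, Sum.elim_inr]
  have hgA : ContinuousOn (g i) (spectrum ℝ A) := (hg i).continuousOn
  have hhB : ContinuousOn (h i) (spectrum ℝ B) := (hh i).continuousOn
  rw [cfc_mul (fun x : ℝ => x) (g i) A, cfc_id' ℝ A, cfc_mul (fun x : ℝ => -x) (h i) B,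
    cfc_neg (fun x : ℝ => x) B, cfc_id' ℝ B, hadj (cfc_predicate (g i) A), mul_apply_eq_comp, mul_apply_eq_comp,
    mul_apply_eq_comp, hadj hA1, hadj (cfc_predicate (g i) A), mul_apply_eq_comp,
    _root_.sub_apply, map_sub, inner_sub_right]
  simp [sub_eq_add_neg]

theorem norm_le_of_forall_re_inner_le {E : Type*} [NormedAddCommGroup E] [InnerProductSpace ℂ E]
    {T : E →L[ℂ] E} {C : ℝ} (hC : 0 ≤ C)
    (hT : ∀ η ξ, Complex.re (inner ℂ η (T ξ)) ≤ C * ‖η‖ * ‖ξ‖) : ‖T‖ ≤ C := by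
  refine T.opNorm_le_bound hC fun ξ => ?_
  have h1 := hT (T ξ) ξ
  have h2 : Complex.re (inner ℂ (T ξ) (T ξ)) = ‖T ξ‖ ^ 2 := inner_self_eq_norm_sq (𝕜 := ℂ) _
  rw [h2] at h1
  rcases (norm_nonneg (T ξ)).eq_or_lt with h | h
  · rw [← h]; positivity
  · nlinarith

/-- Finite sums `∑ g i (A) (A - B) h i (B)` approximate `f(A) - f(B)`, with an error that is small
relative to `‖A - B‖`. -/
theorem norm_cfc_sub_cfc_sub_sum_le {ι : Type*} {J : Set ℝ} (hJ : IsCompact J) (hf : Continuous f)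
    (hfk : ∀ x y, f x - f y = (x - y) * k x y) {g h : ι → ℝ → ℝ} (hg : ∀ i, Continuous (g i))
    (hh : ∀ i, Continuous (h i)) (hgt : SmallSquareTails g J) (hht : SmallSquareTails h J)
    (hsum : ∀ x ∈ J, ∀ y ∈ J, HasSum (fun i => g i x * h i y) (k x y)) {ε : ℝ} (hε : 0 < ε) :
    ∃ F : Finset ι, ∀ A ∈ selfAdjointWithSpectrumIn H J, ∀ B ∈ selfAdjointWithSpectrumIn H J,
      ‖cfc f A - cfc f B - ∑ i ∈ F, cfc (g i) A * (A - B) * cfc (h i) B‖ ≤ ε * ‖A - B‖ := by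
  classical
  obtain ⟨F₁, hF₁⟩ := hgt ε hε
  obtain ⟨F₂, hF₂⟩ := hht ε hε
  refine ⟨F₁ ∪ F₂, fun A hA B hB => norm_le_of_forall_re_inner_le (by positivity) fun η ξ => ?_⟩
  have hlim := (hasSum_re_inner_cfc_sub_cfc hJ hf hfk hg hh hgt hht hsum hA hB η ξ).sub_const
    (∑ i ∈ F₁ ∪ F₂, Complex.re (inner ℂ η ((cfc (g i) A * (A - B) * cfc (h i) B) ξ)))
  rw [_root_.sub_apply, inner_sub_right, Complex.sub_re, _root_.sum_apply, inner_sum,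
    Complex.re_sum]
  -- It suffices to bound finite blocks outside `F₁ ∪ F₂`, where Cauchy–Schwarz and the two tail
  -- bounds give one factor `ε`.
  refine le_of_tendsto hlim ((eventually_ge_atTop (F₁ ∪ F₂)).mono fun F hF => ?_)
  rw [← Finset.sum_sdiff (show F₁ ∪ F₂ ⊆ F from hF), add_sub_cancel_right]
  have hdisj : Disjoint (F \ (F₁ ∪ F₂)) (F₁ ∪ F₂) := Finset.sdiff_disjoint
  have h1 := sum_norm_sq_cfc_apply_le hA (fun i => (hg i).continuousOn) (F \ (F₁ ∪ F₂)) hε.le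
    (hF₁ _ (hdisj.mono_right Finset.subset_union_left)) η
  have h2 := sum_norm_sq_cfc_apply_le hB (fun i => (hh i).continuousOn) (F \ (F₁ ∪ F₂)) hε.le
    (hF₂ _ (hdisj.mono_right Finset.subset_union_right)) ξ
  calc ∑ i ∈ F \ (F₁ ∪ F₂), Complex.re (inner ℂ η ((cfc (g i) A * (A - B) * cfc (h i) B) ξ))
      ≤ ∑ i ∈ F \ (F₁ ∪ F₂), ‖A - B‖ * (‖cfc (g i) A η‖ * ‖cfc (h i) B ξ‖) := by
        refine Finset.sum_le_sum fun i _ => (Complex.re_le_norm _).trans ?_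
        have hsa : IsSelfAdjoint (cfc (g i) A) := cfc_predicate _ _
        rw [mul_apply_eq_comp, mul_apply_eq_comp, ← ContinuousLinearMap.adjoint_inner_left,
          hsa.adjoint_eq]
        refine (norm_inner_le_norm _ _).trans ?_
        calc ‖cfc (g i) A η‖ * ‖(A - B) (cfc (h i) B ξ)‖
            ≤ ‖cfc (g i) A η‖ * (‖A - B‖ * ‖cfc (h i) B ξ‖) := by
              gcongr; exact (A - B).le_opNorm _
          _ = _ := by ring
    _ = ‖A - B‖ * ∑ i ∈ F \ (F₁ ∪ F₂), ‖cfc (g i) A η‖ * ‖cfc (h i) B ξ‖ := by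
        rw [Finset.mul_sum]
    _ ≤ ‖A - B‖ * (ε * ‖η‖ * ‖ξ‖) := by
        gcongr
        refine abs_le_of_sq_le_sq' ?_ (by positivity) |>.2
        refine (Finset.sum_mul_sq_le_sq_mul_sq _ _ _).trans ?_
        calc _ ≤ (ε * ‖η‖ ^ 2) * (ε * ‖ξ‖ ^ 2) := by gcongr
          _ = _ := by ring
    _ = ε * ‖A - B‖ * ‖η‖ * ‖ξ‖ := by ring

end Factorization

/-! ### Existence of the directional derivative in norm. -/

section DirectionalDerivative

variable {H : Type*} [NormedAddCommGroup H] [InnerProductSpace ℂ H] [CompleteSpace H]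
variable {f : ℝ → ℝ} {k : ℝ → ℝ → ℝ}

theorem exists_tendsto_of_forall_approx {α E : Type*} [PseudoMetricSpace E] [CompleteSpace E]
    [Nonempty E] {l : Filter α} {q : α → E}
    (h : ∀ ε > 0, ∃ y, ∀ᶠ s in l, dist (q s) y ≤ ε) : ∃ L, Tendsto q l (𝓝 L) := by
  rcases l.eq_or_neBot with rfl | hl
  · exact ⟨Classical.arbitrary E, tendsto_bot⟩
  rw [← cauchy_map_iff_exists_tendsto, Metric.cauchy_iff]
  refine ⟨inferInstance, fun ε hε => ?_⟩
  obtain ⟨y, hy⟩ := h (ε / 3) (by positivity)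
  refine ⟨_, image_mem_map hy, ?_⟩
  rintro _ ⟨a, ha, rfl⟩ _ ⟨b, hb, rfl⟩
  have h1 := dist_triangle_right (q a) (q b) y
  have h2 : dist (q a) y ≤ ε / 3 := ha
  have h3 : dist (q b) y ≤ ε / 3 := hb
  linarith

theorem tendsto_cfc_add_smul {J : Set ℝ} (hJ : IsCompact J) {g : ℝ → ℝ} (hg : Continuous g)
    {A X : H →L[ℂ] H} (hA : A ∈ selfAdjointWithSpectrumIn H J) {l : Filter ℝ} (hl : l ≤ 𝓝 0)
    (hmem : ∀ᶠ s in l, A + s • X ∈ selfAdjointWithSpectrumIn H J) :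
    Tendsto (fun s : ℝ => cfc g (A + s • X)) l (𝓝 (cfc g A)) := by
  have h1 : Tendsto (fun s : ℝ => A + s • X) l (𝓝 A) := by
    have : Continuous fun s : ℝ => A + s • X := by fun_prop
    simpa using (this.tendsto 0).mono_left hl
  exact h1.cfc hJ g (hmem.mono fun s hs => hs.2) (hmem.mono fun s hs => hs.1) hA.2 hA.1

/-- The spectral projections of `A` resolve the identity, so the quotient equals `∑ P i X k(x i, A +
sX)`, a finite sum continuous in `s`. -/
theorem exists_tendsto_quotient_of_finiteDimensional [FiniteDimensional ℂ H] {J : Set ℝ}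
    (hJ : IsCompact J) (hf : Continuous f) (hk : Continuous (Function.uncurry k))
    (hfk : ∀ x y, f x - f y = (x - y) * k x y) {A X : H →L[ℂ] H}
    (hA : A ∈ selfAdjointWithSpectrumIn H J) {l : Filter ℝ} (hl : l ≤ 𝓝 0)
    (hmem : ∀ᶠ s in l, s ≠ 0 ∧ A + s • X ∈ selfAdjointWithSpectrumIn H J) :
    ∃ L, Tendsto (fun s : ℝ => s⁻¹ • (cfc f (A + s • X) - cfc f A)) l (𝓝 L) := by
  have hA1 : IsSelfAdjoint A := hA.1
  have hsymm : (A : H →ₗ[ℂ] H).IsSymmetric :=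
    (ContinuousLinearMap.isSelfAdjoint_iff_isSymmetric).1 hA1
  let b := hsymm.eigenvectorBasis rfl
  let x := hsymm.eigenvalues rfl
  have hb : ∀ i, A (b i) = x i • b i := fun i => hsymm.apply_eigenvectorBasis rfl i
  let P : Fin (Module.finrank ℂ H) → H →L[ℂ] H := fun i => InnerProductSpace.rankOne ℂ (b i) (b i)
  have hP : ∀ T : H →L[ℂ] H, T = ∑ i, P i * T := by
    intro T
    ext ξ
    simp only [_root_.sum_apply, mul_apply_eq_comp, P, InnerProductSpace.rankOne_apply]
    exact (b.sum_repr' (T ξ)).symm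
  refine ⟨∑ i, P i * X * cfc (k (x i)) A, ?_⟩
  have hlim : Tendsto (fun s : ℝ => ∑ i, P i * X * cfc (k (x i)) (A + s • X)) l
      (𝓝 (∑ i, P i * X * cfc (k (x i)) A)) :=
    tendsto_finsetSum _ fun i _ => (tendsto_cfc_add_smul hJ
      (hk.comp (continuous_const.prodMk continuous_id)) hA hl
      (hmem.mono fun s hs => hs.2)).const_mul _
  refine hlim.congr' ?_
  filter_upwards [hmem] with s hs
  rw [hP (s⁻¹ • (cfc f (A + s • X) - cfc f A))]
  refine Finset.sum_congr rfl fun i _ => ?_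
  ext ξ
  simp only [mul_apply_eq_comp, P, InnerProductSpace.rankOne_apply, _root_.smul_apply]
  congr 1
  rw [inner_smul_right_eq_smul,
    inner_cfc_sub_cfc_of_eigenvector hf hk hfk hA1 hs.2.1 (hb i) ξ, ← inner_smul_right_eq_smul,
    add_sub_cancel_left, smul_mul_assoc, _root_.smul_apply, smul_smul, inv_mul_cancel₀ hs.1,
    one_smul, mul_apply_eq_comp]

/-- The quotient is uniformly close to `∑ g i (A + sX) X h i (A)` over a finite set: the
factorization error is relative to `‖sX‖`, so dividing by `s` is harmless. -/
theorem exists_tendsto_quotient_of_infinite (hH : ¬FiniteDimensional ℂ H) {m M : ℝ} (hmM : m < M)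
    (hf : Continuous f) (hk : Continuous (Function.uncurry k))
    (hfk : ∀ x y, f x - f y = (x - y) * k x y) (hconv : OperatorConvexOn H (Icc m M) f)
    {A X : H →L[ℂ] H} (hA : A ∈ selfAdjointWithSpectrumIn H (Icc m M)) {l : Filter ℝ}
    (hl : l ≤ 𝓝 0) (hmem : ∀ᶠ s in l, s ≠ 0 ∧ A + s • X ∈ selfAdjointWithSpectrumIn H (Icc m M)) :
    ∃ L, Tendsto (fun s : ℝ => s⁻¹ • (cfc f (A + s • X) - cfc f A)) l (𝓝 L) := by
  obtain ⟨ι, g, h, hg, hh, hgt, hht, hsum⟩ :=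
    exists_dividedDifference_factorization hH hk hfk hf hmM hconv
  refine exists_tendsto_of_forall_approx fun ε hε => ?_
  obtain ⟨F, hF⟩ := norm_cfc_sub_cfc_sub_sum_le (H := H) isCompact_Icc hf hfk hg hh hgt hht hsum
    (ε := ε / (2 * (‖X‖ + 1))) (by positivity)
  refine ⟨∑ i ∈ F, cfc (g i) A * X * cfc (h i) A, ?_⟩
  have hlim : Tendsto (fun s : ℝ => ∑ i ∈ F, cfc (g i) (A + s • X) * X * cfc (h i) A) l
      (𝓝 (∑ i ∈ F, cfc (g i) A * X * cfc (h i) A)) :=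
    tendsto_finsetSum _ fun i _ => ((tendsto_cfc_add_smul isCompact_Icc (hg i) hA hl
      (hmem.mono fun s hs => hs.2)).mul_const _).mul_const _
  filter_upwards [hmem, (Metric.tendsto_nhds.1 hlim) (ε / 2) (half_pos hε)] with s hs hs2
  have h1 := hF _ hs.2 A hA
  rw [add_sub_cancel_left, norm_smul] at h1
  have h2 : dist (s⁻¹ • (cfc f (A + s • X) - cfc f A))
      (∑ i ∈ F, cfc (g i) (A + s • X) * X * cfc (h i) A) ≤ ε / 2 := by
    have h3 : s⁻¹ • (cfc f (A + s • X) - cfc f A)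
        - ∑ i ∈ F, cfc (g i) (A + s • X) * X * cfc (h i) A
        = s⁻¹ • (cfc f (A + s • X) - cfc f A
          - ∑ i ∈ F, cfc (g i) (A + s • X) * (s • X) * cfc (h i) A) := by
      simp only [smul_sub, Finset.smul_sum, mul_smul_comm, smul_mul_assoc, smul_smul,
        inv_mul_cancel₀ hs.1, one_smul]
    rw [dist_eq_norm, h3, norm_smul, norm_inv]
    have hs0 : 0 < ‖s‖ := norm_pos_iff.2 hs.1
    calc ‖s‖⁻¹ * _ ≤ ‖s‖⁻¹ * (ε / (2 * (‖X‖ + 1)) * (‖s‖ * ‖X‖)) := by gcongr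
      _ = ε / 2 * (‖X‖ / (‖X‖ + 1)) := by field_simp
      _ ≤ ε / 2 * 1 := by
          gcongr
          exact (div_le_one (by positivity)).2 (by linarith)
      _ = ε / 2 := mul_one _
  linarith [dist_triangle (s⁻¹ • (cfc f (A + s • X) - cfc f A))
    (∑ i ∈ F, cfc (g i) (A + s • X) * X * cfc (h i) A) (∑ i ∈ F, cfc (g i) A * X * cfc (h i) A)]

theorem exists_tendsto_quotient {m M : ℝ}
    (hf : Continuous f) (hk : Continuous (Function.uncurry k))
    (hfk : ∀ x y, f x - f y = (x - y) * k x y) (hconv : OperatorConvexOn H (Icc m M) f)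
    {A X : H →L[ℂ] H} (hA : A ∈ selfAdjointWithSpectrumIn H (Icc m M)) {l : Filter ℝ}
    (hl : l ≤ 𝓝 0) (hmem : ∀ᶠ s in l, s ≠ 0 ∧ A + s • X ∈ selfAdjointWithSpectrumIn H (Icc m M)) :
    ∃ L, Tendsto (fun s : ℝ => s⁻¹ • (cfc f (A + s • X) - cfc f A)) l (𝓝 L) := by
  by_cases hH : FiniteDimensional ℂ H
  · exact exists_tendsto_quotient_of_finiteDimensional isCompact_Icc hf hk hfk hA hl hmem
  rcases lt_or_ge m M with hmM | hmM
  · exact exists_tendsto_quotient_of_infinite hH hmM hf hk hfk hconv hA hl hmem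
  · have hconst : ∀ {C : H →L[ℂ] H}, C ∈ selfAdjointWithSpectrumIn H (Icc m M) →
        C = algebraMap ℝ (H →L[ℂ] H) m := by
      intro C hC
      rw [mem_selfAdjointWithSpectrumIn_Icc] at hC
      exact le_antisymm (hC.2.2.trans (algebraMap_mono _ hmM)) hC.2.1
    refine ⟨0, tendsto_const_nhds.congr' ?_⟩
    filter_upwards [hmem] with s hs
    rw [hconst hs.2, hconst hA, sub_self, smul_zero]

/-- A `C¹` function on an interval agrees on a compact subinterval with a function on the line
whose first divided difference extends continuously to the plane. -/
theorem exists_continuous_dividedDifference {m M : ℝ} (hmM : m ≤ M)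
    (hf : ContDiffOn ℝ 1 f (Icc m M)) :
    ∃ (F : ℝ → ℝ) (k : ℝ → ℝ → ℝ), Continuous F ∧ Continuous (Function.uncurry k) ∧
      (∀ x y, F x - F y = (x - y) * k x y) ∧ EqOn f F (Icc m M) := by
  rcases hmM.eq_or_lt with rfl | hlt
  · refine ⟨fun _ => f m, fun _ _ => 0, continuous_const, continuous_const, by simp, ?_⟩
    rintro x ⟨h1, h2⟩
    rw [le_antisymm h2 h1]
  have hd : ContinuousOn (derivWithin f (Icc m M)) (Icc m M) :=
    hf.continuousOn_derivWithin (uniqueDiffOn_Icc hlt) le_rfl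
  -- The derivative is extended by its end values; `F` is its primitive and `k` its mean over the
  -- segment from `y` to `x`.
  let g : ℝ → ℝ := IccExtend hmM ((Icc m M).domRestrict (derivWithin f (Icc m M)))
  have hg : Continuous g := (continuousOn_iff_continuous_domRestrict.1 hd).Icc_extend'
  have hgd : EqOn g (derivWithin f (Icc m M)) (Icc m M) := fun x hx => by
    simp [g, IccExtend_of_mem hmM _ hx]
  have hint : ∀ a b, IntervalIntegrable g volume a b := fun a b => hg.intervalIntegrable a b
  have hfk : ∀ x y, (f m + ∫ t in m..x, g t) - (f m + ∫ t in m..y, g t)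
      = (x - y) * ∫ t in (0 : ℝ)..1, g (y + (x - y) * t) := by
    intro x y
    rw [add_sub_add_left_eq_sub, intervalIntegral.integral_interval_sub_left (hint _ _) (hint _ _),
      ← smul_eq_mul, intervalIntegral.smul_integral_comp_add_mul]
    simp
  refine ⟨fun x => f m + ∫ t in m..x, g t, fun x y => ∫ t in (0 : ℝ)..1, g (y + (x - y) * t),
    ?_, ?_, hfk, fun x hx => ?_⟩
  · exact continuous_const.add (intervalIntegral.continuous_primitive hint m)
  · refine intervalIntegral.continuous_parametric_intervalIntegral_of_continuous' ?_ 0 1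
    change Continuous fun p : (ℝ × ℝ) × ℝ => g (p.1.2 + (p.1.1 - p.1.2) * p.2)
    exact hg.comp (by fun_prop)
  · have hsub : Icc m x ⊆ Icc m M := Icc_subset_Icc_right hx.2
    have h1 : ∫ t in m..x, g t = f x - f m := by
      refine intervalIntegral.integral_eq_sub_of_hasDerivAt_of_le hx.1
        (hf.continuousOn.mono hsub) (fun t ht => ?_) (hint _ _)
      have ht' : t ∈ Icc m M := hsub (Ioo_subset_Icc_self ht)
      rw [hgd ht']
      exact ((hf.differentiableOn one_ne_zero t ht').hasDerivWithinAt).hasDerivAt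
        (Icc_mem_nhds ht.1 (ht.2.trans_le hx.2))
    simp [h1]

theorem OperatorConvexOn.congr_Icc {I : Set ℝ} {F : ℝ → ℝ} {m M : ℝ}
    (hconv : OperatorConvexOn H I f) (hI : Icc m M ⊆ I) (hfF : EqOn f F (Icc m M)) :
    OperatorConvexOn H (Icc m M) F := by
  have hcfc : ∀ {A : H →L[ℂ] H}, A ∈ selfAdjointWithSpectrumIn H (Icc m M) → cfc F A = cfc f A :=
    fun hA => (cfc_congr (hfF.mono hA.2)).symm
  refine ⟨(hconv.1.mono hI).congr fun x hx => (hfF hx).symm, fun A hA B hB t ht => ?_⟩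
  rw [hcfc hA, hcfc hB, hcfc (arithMean_mem_Icc hA hB ht)]
  exact hconv.2 A (selfAdjointWithSpectrumIn_mono hI hA) B (selfAdjointWithSpectrumIn_mono hI hB)
    t ht

theorem exists_Icc_of_mem [Nontrivial H] {I : Set ℝ} (hI : I.OrdConnected) {A B : H →L[ℂ] H}
    (hA : A ∈ selfAdjointWithSpectrumIn H I) (hB : B ∈ selfAdjointWithSpectrumIn H I) :
    ∃ m M, m ≤ M ∧ Icc m M ⊆ I ∧ A ∈ selfAdjointWithSpectrumIn H (Icc m M) ∧
      B ∈ selfAdjointWithSpectrumIn H (Icc m M) := by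
  have hK : IsCompact (spectrum ℝ A ∪ spectrum ℝ B) :=
    (ContinuousFunctionalCalculus.isCompact_spectrum (R := ℝ) A).union
      (ContinuousFunctionalCalculus.isCompact_spectrum (R := ℝ) B)
  have hne : (spectrum ℝ A ∪ spectrum ℝ B).Nonempty :=
    (ContinuousFunctionalCalculus.spectrum_nonempty A hA.1).mono subset_union_left
  have hKI : spectrum ℝ A ∪ spectrum ℝ B ⊆ I := union_subset hA.2 hB.2
  obtain ⟨m, hm⟩ := hK.exists_isLeast hne
  obtain ⟨M, hM⟩ := hK.exists_isGreatest hne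
  exact ⟨m, M, hm.2 hM.1, hI.out (hKI hm.1) (hKI hM.1),
    ⟨hA.1, fun x hx => ⟨hm.2 (.inl hx), hM.2 (.inl hx)⟩⟩,
    ⟨hB.1, fun x hx => ⟨hm.2 (.inr hx), hM.2 (.inr hx)⟩⟩⟩

/-- Near `0`, a subset of the line containing `0` lies between two of its points. -/
theorem exists_eventually_mem_Icc {T : Set ℝ} (h0 : (0 : ℝ) ∈ T) :
    ∃ a ∈ T, ∃ b ∈ T, a ≤ 0 ∧ 0 ≤ b ∧ ∀ᶠ s in 𝓝[T] 0, s ∈ Icc a b := by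
  obtain ⟨a, haT, ha0, ha⟩ : ∃ a ∈ T, a ≤ 0 ∧ ∀ᶠ s in 𝓝[T] (0 : ℝ), a ≤ s := by
    by_cases h : ∃ a ∈ T, a < 0
    · obtain ⟨a, haT, ha⟩ := h
      exact ⟨a, haT, ha.le, mem_nhdsWithin_of_mem_nhds (Ici_mem_nhds ha)⟩
    · push Not at h
      exact ⟨0, h0, le_rfl, eventually_mem_nhdsWithin.mono h⟩
  obtain ⟨b, hbT, hb0, hb⟩ : ∃ b ∈ T, 0 ≤ b ∧ ∀ᶠ s in 𝓝[T] (0 : ℝ), s ≤ b := by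
    by_cases h : ∃ b ∈ T, 0 < b
    · obtain ⟨b, hbT, hb⟩ := h
      exact ⟨b, hbT, hb.le, mem_nhdsWithin_of_mem_nhds (Iic_mem_nhds hb)⟩
    · push Not at h
      exact ⟨0, h0, le_rfl, eventually_mem_nhdsWithin.mono h⟩
  exact ⟨a, haT, b, hbT, ha0, hb0, ha.and hb⟩

/-- The directional derivative of an operator convex `C¹` function exists in norm. -/
theorem exists_hasOperatorDirDeriv {I : Set ℝ} (hI : I.OrdConnected)
    (hconv : OperatorConvexOn H I f) (hC1 : ContDiffOn ℝ 1 f I) {A : H →L[ℂ] H}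
    (hA : A ∈ selfAdjointWithSpectrumIn H I) (X : H →L[ℂ] H) :
    ∃ L, HasOperatorDirDeriv I f A X L := by
  rcases subsingleton_or_nontrivial H with hH | hH
  · exact ⟨0, tendsto_const_nhds.congr fun s => Subsingleton.elim _ _⟩
  set T : Set ℝ := {s | A + s • X ∈ selfAdjointWithSpectrumIn H I} with hT
  have h0 : (0 : ℝ) ∈ T := by simpa [hT] using hA
  -- One compact interval must serve all small admissible `s`, even when `I` is not open and `s` is
  -- one-sided. Two endpoints `a`, `b` control the segment between them.
  obtain ⟨a, ha, b, hb, ha0, hb0, hab⟩ := exists_eventually_mem_Icc h0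
  obtain ⟨m, M, hmM, hmMI, hAa, hAb⟩ := exists_Icc_of_mem hI ha hb
  have hmem : ∀ s ∈ Icc a b, A + s • X ∈ selfAdjointWithSpectrumIn H (Icc m M) := by
    intro s hs
    rcases (hs.1.trans hs.2).eq_or_lt with h | h
    · rwa [le_antisymm (hs.2.trans h.ge) hs.1]
    · have hne : b - a ≠ 0 := (sub_pos.2 h).ne'
      have : A + s • X = arithMean (A + a • X) (A + b • X) ((s - a) / (b - a)) := by
        have hs' : s = (1 - (s - a) / (b - a)) * a + (s - a) / (b - a) * b := by
          field_simp; ring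
        conv_lhs => rw [hs']
        rw [arithMean]
        module
      rw [this]
      exact arithMean_mem_Icc hAa hAb ⟨div_nonneg (sub_nonneg.2 hs.1) (sub_pos.2 h).le,
        (div_le_one (sub_pos.2 h)).2 (by linarith [hs.2])⟩
  have hAJ : A ∈ selfAdjointWithSpectrumIn H (Icc m M) := by
    simpa using hmem 0 ⟨ha0, hb0⟩
  obtain ⟨F, k, hF, hk, hFk, hfF⟩ := exists_continuous_dividedDifference hmM (hC1.mono hmMI)
  set l := 𝓝[{s : ℝ | s ≠ 0 ∧ A + s • X ∈ selfAdjointWithSpectrumIn H I}] (0 : ℝ) with hl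
  have hlmem : ∀ᶠ s in l, s ≠ 0 ∧ A + s • X ∈ selfAdjointWithSpectrumIn H (Icc m M) := by
    have h1 : ∀ᶠ s in l, s ∈ Icc a b := hab.filter_mono (nhdsWithin_mono _ fun s hs => hs.2)
    filter_upwards [h1, eventually_mem_nhdsWithin] with s hs hs'
    exact ⟨hs'.1, hmem s hs⟩
  obtain ⟨L, hL⟩ := exists_tendsto_quotient hF hk hFk (hconv.congr_Icc hmMI hfF) hAJ
    (X := X) (l := l) nhdsWithin_le_nhds hlmem
  refine ⟨L, hL.congr' ?_⟩
  filter_upwards [hlmem] with s hs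
  rw [cfc_congr (hfF.mono hs.2.2), cfc_congr (hfF.mono hAJ.2)]

end DirectionalDerivative

/-! ### Convexity along the segment. -/

section GradientInequality

variable {H : Type*} [NormedAddCommGroup H] [InnerProductSpace ℂ H] [CompleteSpace H]
variable {I : Set ℝ} {f : ℝ → ℝ} {A B : H →L[ℂ] H}

theorem arithMean_mem (hI : I.OrdConnected) (hA : A ∈ selfAdjointWithSpectrumIn H I)
    (hB : B ∈ selfAdjointWithSpectrumIn H I) {t : ℝ} (ht : t ∈ Icc (0 : ℝ) 1) :
    arithMean A B t ∈ selfAdjointWithSpectrumIn H I := by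
  rcases subsingleton_or_nontrivial H with hH | hH
  · rwa [Subsingleton.elim (arithMean A B t) A]
  · obtain ⟨m, M, -, hI', hA', hB'⟩ := exists_Icc_of_mem hI hA hB
    exact selfAdjointWithSpectrumIn_mono hI' (arithMean_mem_Icc hA' hB' ht)

theorem arithMean_add_smul {E : Type*} [NormedAddCommGroup E] [InnerProductSpace ℂ E]
    (A B : E →L[ℂ] E) (t s : ℝ) :
    arithMean A B t + s • (B - A) = arithMean A B (t + s) := by
  simp only [arithMean]; module

theorem arithMean_arithMean {E : Type*} [NormedAddCommGroup E] [InnerProductSpace ℂ E]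
    (A B : E →L[ℂ] E) (t u r : ℝ) :
    arithMean (arithMean A B t) (arithMean A B u) r = arithMean A B (t + r * (u - t)) := by
  simp only [arithMean]; module

theorem continuousOn_cfc_arithMean (hI : I.OrdConnected) (hf : ContinuousOn f I)
    (hA : A ∈ selfAdjointWithSpectrumIn H I) (hB : B ∈ selfAdjointWithSpectrumIn H I) :
    ContinuousOn (fun t : ℝ => cfc f (arithMean A B t)) (Icc 0 1) := by
  rcases subsingleton_or_nontrivial H with hH | hH
  · exact (continuousOn_const (c := (0 : H →L[ℂ] H))).congr fun t _ => Subsingleton.elim _ _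
  · obtain ⟨m, M, -, hI', hA', hB'⟩ := exists_Icc_of_mem hI hA hB
    have hc : Continuous fun t : ℝ => arithMean A B t := by unfold arithMean; fun_prop
    exact hc.continuousOn.cfc' isCompact_Icc f (fun t ht => (arithMean_mem_Icc hA' hB' ht).2)
      (fun t ht => (arithMean_mem_Icc hA' hB' ht).1) (hf.mono hI')

theorem hasOperatorDirDeriv_operatorDirDeriv {X L : H →L[ℂ] H} (h : HasOperatorDirDeriv I f A X L) :
    HasOperatorDirDeriv I f A X (operatorDirDeriv I f A X) := by
  have hex : ∃ L, HasOperatorDirDeriv I f A X L := ⟨L, h⟩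
  rw [operatorDirDeriv, dif_pos hex]
  exact hex.choose_spec

/-- The gradient inequality of an operator convex function along a segment. -/
theorem smul_dirDeriv_le (hI : I.OrdConnected) (hconv : OperatorConvexOn H I f)
    (hA : A ∈ selfAdjointWithSpectrumIn H I) (hB : B ∈ selfAdjointWithSpectrumIn H I) {t u : ℝ}
    (ht : t ∈ Icc (0 : ℝ) 1) (hu : u ∈ Icc (0 : ℝ) 1) {L : H →L[ℂ] H}
    (hL : HasOperatorDirDeriv I f (arithMean A B t) (B - A) L) :
    (u - t) • L ≤ cfc f (arithMean A B u) - cfc f (arithMean A B t) := by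
  rcases eq_or_ne u t with rfl | hut
  · simp
  have hseg : ∀ r ∈ Icc (0 : ℝ) 1, t + r * (u - t) ∈ Icc (0 : ℝ) 1 := fun r hr =>
    ⟨by nlinarith [ht.1, hu.1, hr.1, hr.2], by nlinarith [ht.2, hu.2, hr.1, hr.2]⟩
  have hr01 : ∀ᶠ r : ℝ in 𝓝[>] 0, r ∈ Ioo (0 : ℝ) 1 := Ioo_mem_nhdsGT one_pos
  -- Substituting `s = r (u - t)` with `r → 0+` approaches `t` from the side of `u`, so endpoints
  -- and both signs of `u - t` are covered.
  have hmap : Tendsto (fun r : ℝ => r * (u - t)) (𝓝[>] 0)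
      (𝓝[{s : ℝ | s ≠ 0 ∧ arithMean A B t + s • (B - A) ∈ selfAdjointWithSpectrumIn H I}] 0) := by
    refine tendsto_nhdsWithin_iff.2 ⟨?_, ?_⟩
    · have : Continuous fun r : ℝ => r * (u - t) := by fun_prop
      simpa using (this.tendsto 0).mono_left nhdsWithin_le_nhds
    · filter_upwards [hr01] with r hr
      refine ⟨mul_ne_zero hr.1.ne' (sub_ne_zero.2 hut), ?_⟩
      rw [arithMean_add_smul]
      exact arithMean_mem hI hA hB (hseg r (Ioo_subset_Icc_self hr))
  have hlim := (Tendsto.comp hL hmap).const_smul (u - t)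
  refine le_of_tendsto hlim ?_
  filter_upwards [hr01] with r hr
  have hr0 : r ≠ 0 := hr.1.ne'
  have hut' : u - t ≠ 0 := sub_ne_zero.2 hut
  have h1 := hconv.2 _ (arithMean_mem hI hA hB ht) _ (arithMean_mem hI hA hB hu) r
    (Ioo_subset_Icc_self hr)
  simp only [Function.comp]
  rw [smul_smul, show (u - t) * (r * (u - t))⁻¹ = r⁻¹ by field_simp, arithMean_add_smul,
    ← arithMean_arithMean]
  have h2 : cfc f (arithMean (arithMean A B t) (arithMean A B u) r) - cfc f (arithMean A B t)
      ≤ r • (cfc f (arithMean A B u) - cfc f (arithMean A B t)) := by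
    refine (sub_le_sub_right h1 _).trans_eq ?_
    simp only [arithMean]; module
  calc _ ≤ r⁻¹ • (r • (cfc f (arithMean A B u) - cfc f (arithMean A B t))) :=
        smul_le_smul_of_nonneg_left h2 (inv_nonneg.2 hr.1.le)
    _ = _ := by rw [smul_smul, inv_mul_cancel₀ hr0, one_smul]

theorem hasDerivAt_cfc_arithMean (hI : I.OrdConnected)
    (hA : A ∈ selfAdjointWithSpectrumIn H I) (hB : B ∈ selfAdjointWithSpectrumIn H I) {t : ℝ}
    (ht : t ∈ Ioo (0 : ℝ) 1) {L : H →L[ℂ] H}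
    (hL : HasOperatorDirDeriv I f (arithMean A B t) (B - A) L) :
    HasDerivAt (fun t : ℝ => cfc f (arithMean A B t)) L t := by
  rw [hasDerivAt_iff_tendsto_slope_zero]
  simp only [HasOperatorDirDeriv, arithMean_add_smul] at hL
  refine hL.mono_left ?_
  rw [nhdsWithin_le_iff]
  have h1 : ∀ᶠ s in 𝓝[≠] (0 : ℝ), t + s ∈ Ioo (0 : ℝ) 1 := by
    have : Continuous fun s : ℝ => t + s := by fun_prop
    have h2 : Tendsto (fun s : ℝ => t + s) (𝓝[≠] 0) (𝓝 t) := by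
      simpa using (this.tendsto 0).mono_left nhdsWithin_le_nhds
    exact h2.eventually (isOpen_Ioo.mem_nhds ht)
  filter_upwards [h1, eventually_mem_nhdsWithin] with s hs hs0
  exact ⟨hs0, arithMean_mem hI hA hB (Ioo_subset_Icc_self hs)⟩

end GradientInequality

/-! ### Jensen's inequality and the weight measure. -/

section Integration

/-- A function on `[0, 1]` with a monotone family of subgradients satisfies the two-sided Jensen
inequality for every probability measure on `[0, 1]`. -/
theorem jensen_of_subgradient {E : Type*} [NormedAddCommGroup E] [NormedSpace ℝ E]
    [CompleteSpace E] [PartialOrder E] [IsOrderedAddMonoid E] [IsOrderedModule ℝ E]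
    [ClosedIciTopology E] {μ : Measure ℝ} [IsProbabilityMeasure μ] (hμ : ∀ᵐ t ∂μ, t ∈ Icc (0 : ℝ) 1)
    {w : ℝ} (hw : w ∈ Icc (0 : ℝ) 1) (hmean : ∫ t, t ∂μ = w) {φ D : ℝ → E}
    (hφ : Integrable φ μ) (hD : Integrable (fun t => (t - w) • D t) μ)
    (hgrad : ∀ t ∈ Icc (0 : ℝ) 1, ∀ u ∈ Icc (0 : ℝ) 1, (u - t) • D t ≤ φ u - φ t) :
    0 ≤ (∫ t, φ t ∂μ) - φ w ∧ (∫ t, φ t ∂μ) - φ w ≤ ∫ t, (t - w) • D t ∂μ := by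
  have hid : Integrable (fun t : ℝ => t) μ := by
    refine Integrable.of_bound (by fun_prop) 1 (hμ.mono fun t ht => ?_)
    rw [Real.norm_eq_abs, abs_le]
    exact ⟨by linarith [ht.1], ht.2⟩
  have hsub : Integrable (fun t => t - w) μ := hid.sub (integrable_const w)
  have hφw : ∫ t, (φ t - φ w) ∂μ = (∫ t, φ t ∂μ) - φ w := by
    rw [integral_sub hφ (integrable_const _)]
    simp
  -- The supporting line at the mean integrates to zero, which gives the lower bound.
  have hzero : ∫ t, (t - w) • D w ∂μ = 0 := by
    rw [integral_smul_const, integral_sub hid (integrable_const w), hmean]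
    simp
  rw [← hφw]
  constructor
  · rw [← hzero]
    exact integral_mono_ae (hsub.smul_const _) (hφ.sub (integrable_const _))
      (hμ.mono fun t ht => hgrad w hw t ht)
  · refine integral_mono_ae (hφ.sub (integrable_const _)) hD (hμ.mono fun t ht => ?_)
    have := hgrad t ht w hw
    rw [← neg_sub t w, neg_smul, ← neg_sub (φ t), neg_le_neg_iff] at this
    exact this

theorem weightMeasure_of_mem_Ioo {w : ℝ} (hw : w ∈ Ioo (0 : ℝ) 1) :
    weightMeasure w = (volume.restrict (Icc (0 : ℝ) 1)).withDensity
      (fun t => ENNReal.ofReal (w / (1 - w) * t ^ ((2 * w - 1) / (1 - w)))) := by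
  rw [weightMeasure, if_neg hw.1.ne', if_neg hw.2.ne]

theorem neg_one_lt_weight_exponent {w : ℝ} (hw : w ∈ Ioo (0 : ℝ) 1) :
    -1 < (2 * w - 1) / (1 - w) := by
  have h1 : 0 < 1 - w := sub_pos.2 hw.2
  rw [lt_div_iff₀ h1]
  linarith [hw.1]

theorem integral_Icc_rpow {p : ℝ} (hp : -1 < p) :
    ∫ t in Icc (0 : ℝ) 1, t ^ p = (p + 1)⁻¹ := by
  rw [integral_Icc_eq_integral_Ioc, ← intervalIntegral.integral_of_le zero_le_one,
    integral_rpow (.inl hp), Real.one_rpow, Real.zero_rpow (by linarith), sub_zero, one_div]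

theorem integrableOn_Icc_rpow {p : ℝ} (hp : -1 < p) :
    IntegrableOn (fun t : ℝ => t ^ p) (Icc (0 : ℝ) 1) := by
  rw [integrableOn_Icc_iff_integrableOn_Ioc, ← intervalIntegrable_iff_integrableOn_Ioc_of_le
    zero_le_one]
  exact intervalIntegral.intervalIntegrable_rpow' hp

theorem isProbabilityMeasure_weightMeasure {w : ℝ} (hw : w ∈ Icc (0 : ℝ) 1) :
    IsProbabilityMeasure (weightMeasure w) := by
  rcases eq_or_ne w 0 with rfl | h0
  · rw [weightMeasure, if_pos rfl]; infer_instance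
  rcases eq_or_ne w 1 with rfl | h1
  · rw [weightMeasure, if_neg one_ne_zero, if_pos rfl]; infer_instance
  have hw' : w ∈ Ioo (0 : ℝ) 1 := ⟨lt_of_le_of_ne hw.1 h0.symm, lt_of_le_of_ne hw.2 h1⟩
  have hw1 : 0 < 1 - w := sub_pos.2 hw'.2
  have hp := neg_one_lt_weight_exponent hw'
  refine ⟨?_⟩
  rw [weightMeasure_of_mem_Ioo hw', withDensity_apply _ MeasurableSet.univ, Measure.restrict_univ,
    ← ofReal_integral_eq_lintegral_ofReal ((integrableOn_Icc_rpow hp).const_mul _),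
    integral_const_mul, integral_Icc_rpow hp]
  · rw [ENNReal.ofReal_eq_one]
    have : (2 * w - 1) / (1 - w) + 1 = w / (1 - w) := by field_simp; ring
    rw [this, mul_inv_cancel₀ (div_pos hw'.1 hw1).ne']
  · filter_upwards [ae_restrict_mem measurableSet_Icc] with t ht
    exact mul_nonneg (div_pos hw'.1 hw1).le (Real.rpow_nonneg ht.1 _)

theorem ae_weightMeasure_mem_Icc {w : ℝ} : ∀ᵐ t ∂(weightMeasure w), t ∈ Icc (0 : ℝ) 1 := by
  rw [weightMeasure]
  split_ifs
  · exact (ae_dirac_iff (p := (· ∈ Icc (0 : ℝ) 1)) measurableSet_Icc).2 (by simp)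
  · exact (ae_dirac_iff (p := (· ∈ Icc (0 : ℝ) 1)) measurableSet_Icc).2 (by simp)
  · exact (withDensity_absolutelyContinuous _ _).ae_le (ae_restrict_mem measurableSet_Icc)

theorem integral_id_weightMeasure {w : ℝ} (hw : w ∈ Icc (0 : ℝ) 1) :
    ∫ t, t ∂(weightMeasure w) = w := by
  rcases eq_or_ne w 0 with rfl | h0
  · rw [weightMeasure, if_pos rfl, integral_dirac]
  rcases eq_or_ne w 1 with rfl | h1
  · rw [weightMeasure, if_neg one_ne_zero, if_pos rfl, integral_dirac]
  have hw' : w ∈ Ioo (0 : ℝ) 1 := ⟨lt_of_le_of_ne hw.1 h0.symm, lt_of_le_of_ne hw.2 h1⟩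
  have hw1 : 0 < 1 - w := sub_pos.2 hw'.2
  have hp := neg_one_lt_weight_exponent hw'
  rw [weightMeasure_of_mem_Ioo hw', integral_withDensity_eq_integral_toReal_smul (by fun_prop)
    (ae_of_all _ fun _ => ENNReal.ofReal_lt_top)]
  have hcongr : ∫ t in Icc (0 : ℝ) 1,
      (ENNReal.ofReal (w / (1 - w) * t ^ ((2 * w - 1) / (1 - w)))).toReal • t
      = ∫ t in Icc (0 : ℝ) 1, w / (1 - w) * t ^ ((2 * w - 1) / (1 - w) + 1) := by
    refine setIntegral_congr_fun measurableSet_Icc fun t ht => ?_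
    rw [ENNReal.toReal_ofReal (mul_nonneg (div_pos hw'.1 hw1).le (Real.rpow_nonneg ht.1 _)),
      smul_eq_mul, mul_assoc, Real.rpow_add_one' ht.1 (by linarith)]
  rw [hcongr, integral_const_mul, integral_Icc_rpow (by linarith)]
  have : (2 * w - 1) / (1 - w) + 1 + 1 = 1 / (1 - w) := by field_simp; ring
  rw [this]
  field_simp

/-- Derivatives are strongly measurable, and the endpoints are null for the densities; for a Dirac
mass every function is measurable. -/
theorem aestronglyMeasurable_weightMeasure {E : Type*} [NormedAddCommGroup E] [NormedSpace ℝ E]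
    [CompleteSpace E] {φ D : ℝ → E} (h : ∀ t ∈ Ioo (0 : ℝ) 1, HasDerivAt φ (D t) t) (w : ℝ) :
    AEStronglyMeasurable D (weightMeasure w) := by
  rw [weightMeasure]
  split_ifs
  · exact aestronglyMeasurable_dirac
  · exact aestronglyMeasurable_dirac
  · refine AEStronglyMeasurable.mono_ac (withDensity_absolutelyContinuous _ _) ?_
    rw [← Measure.restrict_congr_set (Ioo_ae_eq_Icc (a := (0 : ℝ)) (b := 1))]
    refine (aestronglyMeasurable_deriv φ _).congr ?_
    filter_upwards [ae_restrict_mem measurableSet_Ioo] with t ht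
    exact (h t ht).deriv

end Integration


/-! ### The main theorem. -/

theorem theoremT3 {H : Type*} [NormedAddCommGroup H] [InnerProductSpace ℂ H] [CompleteSpace H]
    (I : Set ℝ) (hI : I.OrdConnected) (f : ℝ → ℝ)
    (hconv : OperatorConvexOn H I f) (hC1 : ContDiffOn ℝ 1 f I)
    (A B : H →L[ℂ] H) (hA : A ∈ selfAdjointWithSpectrumIn H I)
    (hB : B ∈ selfAdjointWithSpectrumIn H I)
    (w : ℝ) (hw : w ∈ Icc (0 : ℝ) 1) :
    (∀ t ∈ Icc (0 : ℝ) 1, HasOperatorDirDeriv I f (arithMean A B t) (B - A)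
      (operatorDirDeriv I f (arithMean A B t) (B - A))) ∧
    Integrable (fun t : ℝ => cfc f (arithMean A B t)) (weightMeasure w) ∧
    Integrable (fun t : ℝ => (t - w) • operatorDirDeriv I f (arithMean A B t) (B - A))
      (weightMeasure w) ∧
    0 ≤ (∫ t, cfc f (arithMean A B t) ∂(weightMeasure w)) - cfc f (arithMean A B w) ∧
    (∫ t, cfc f (arithMean A B t) ∂(weightMeasure w)) - cfc f (arithMean A B w) ≤
      ∫ t, (t - w) • operatorDirDeriv I f (arithMean A B t) (B - A) ∂(weightMeasure w) := by
  have := isProbabilityMeasure_weightMeasure hw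
  have hae := ae_weightMeasure_mem_Icc (w := w)
  have hderiv : ∀ t ∈ Icc (0 : ℝ) 1, HasOperatorDirDeriv I f (arithMean A B t) (B - A)
      (operatorDirDeriv I f (arithMean A B t) (B - A)) := fun t ht =>
    hasOperatorDirDeriv_operatorDirDeriv
      (exists_hasOperatorDirDeriv hI hconv hC1 (arithMean_mem hI hA hB ht) (B - A)).choose_spec
  set D : ℝ → H →L[ℂ] H := fun t => operatorDirDeriv I f (arithMean A B t) (B - A) with hD
  set φ : ℝ → H →L[ℂ] H := fun t => cfc f (arithMean A B t) with hφ
  have hgrad : ∀ t ∈ Icc (0 : ℝ) 1, ∀ u ∈ Icc (0 : ℝ) 1, (u - t) • D t ≤ φ u - φ t :=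
    fun t ht u hu => smul_dirDeriv_le hI hconv hA hB ht hu (hderiv t ht)
  -- Combining the gradient inequalities at `t` and at `u` gives monotonicity, which yields the norm
  -- bound on `D` needed for integrability.
  have hmono : ∀ t ∈ Icc (0 : ℝ) 1, ∀ u ∈ Icc (0 : ℝ) 1, t ≤ u → D t ≤ D u := by
    intro t ht u hu htu
    rcases htu.eq_or_lt with rfl | h
    · exact le_rfl
    · have h1 := hgrad t ht u hu
      have h2 := hgrad u hu t ht
      rw [← neg_sub u t, neg_smul, ← neg_sub (φ u), neg_le_neg_iff] at h2
      exact le_of_smul_le_smul_left (h1.trans h2) (sub_pos.2 h)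
  have hφc : ContinuousOn φ (Icc 0 1) := continuousOn_cfc_arithMean hI hconv.1 hA hB
  have hφint : Integrable φ (weightMeasure w) := by
    have hrestr : (weightMeasure w).restrict (Icc 0 1) = weightMeasure w :=
      Measure.restrict_eq_self_of_ae_mem hae
    rw [← hrestr]
    exact hφc.integrableOn_compact isCompact_Icc
  have hDint : Integrable D (weightMeasure w) := by
    refine Integrable.of_bound (aestronglyMeasurable_weightMeasure (φ := φ) (fun t ht =>
      hasDerivAt_cfc_arithMean hI hA hB ht (hderiv t (Ioo_subset_Icc_self ht))) w)
      (‖D 1 - D 0‖ + ‖D 0‖) (hae.mono fun t ht => ?_)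
    have h0 : (0 : ℝ) ∈ Icc (0 : ℝ) 1 := left_mem_Icc.2 zero_le_one
    have h1 : (1 : ℝ) ∈ Icc (0 : ℝ) 1 := right_mem_Icc.2 zero_le_one
    have h2 : ‖D t - D 0‖ ≤ ‖D 1 - D 0‖ := CStarAlgebra.norm_le_norm_of_nonneg_of_le
      (sub_nonneg.2 (hmono 0 h0 t ht ht.1)) (sub_le_sub_right (hmono t ht 1 h1 ht.2) _)
    calc ‖D t‖ = ‖D t - D 0 + D 0‖ := by rw [sub_add_cancel]
      _ ≤ ‖D t - D 0‖ + ‖D 0‖ := norm_add_le _ _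
      _ ≤ ‖D 1 - D 0‖ + ‖D 0‖ := by gcongr
  have hDint' : Integrable (fun t => (t - w) • D t) (weightMeasure w) := by
    refine hDint.bdd_smul 1 (φ := fun t => t - w) (by fun_prop) (hae.mono fun t ht => ?_)
    rw [Real.norm_eq_abs, abs_le]
    exact ⟨by linarith [ht.1, hw.2], by linarith [ht.2, hw.1]⟩
  exact ⟨hderiv, hφint, hDint',
    jensen_of_subgradient hae hw (integral_id_weightMeasure hw) hφint hDint' hgrad⟩
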